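/- Let $T>0$ and let $W=(W_s)_{s\in[0,T]}$ be a one-dimensional standard Brownian motion on a complete probability space $(\Omega,\mathcal F,\mathbb P)$, with its right-continuous, completed natural filtration $(\mathcal F_s)_{s\in[0,T]}$. Let $r:[0,T]\to\mathbb R$ and $\vartheta:[0,T]\to(0,\infty)$ be continuous deterministic functions, put $$\Lambda_s=\exp\Big(-\int_0^s\vartheta_v\,dW_v-\tfrac12\int_0^s|\vartheta_v|^2\,dv\Big),\qquad \frac{d\tilde{\mathbb P}}{d\mathbb P}=\Lambda_T ,$$ and write $\tilde{\mathbb E}$ for the expectation under $\tilde{\mathbb P}$. Let $\zeta\in L^2(\mathbb P)$ with $\zeta\ge 0$ a.s. and $\mathbb E[\zeta]<1$, and put $\kappa=1-\mathbb E[\zeta]$. Let $\theta,\rho>0$ and $c,x\in\mathbb R$. Fix $t\in[0,T)$ and $z>0$. Consider the following system for a pair $(h,w)$ of real-valued $\mathcal F_t$-measurable random variables (equalities holding $\mathbb P$-a.s.): $$\kappa z=\frac{\theta\rho}{\theta+\rho}\,\mathbb E\Big[\Big(\frac h\kappa-c-\frac{\theta+\rho}{\theta\rho}\zeta+w\frac{\Lambda_T}{\Lambda_t}\Big)_+\Big|\mathcal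 F_t\Big],$$ $$w\rho e^{\int_t^T|\vartheta_v|^2dv}-\rho\Big(c-xe^{\int_t^Tr_vdv}\Big)-\tilde{\mathbb E}[\zeta|\mathcal F_t]=\frac{\theta\rho}{\theta+\rho}\,\tilde{\mathbb E}\Big[\Big(\frac h\kappa-c-\frac{\theta+\rho}{\theta\rho}\zeta+w\frac{\Lambda_T}{\Lambda_t}\Big)_+\Big|\mathcal F_t\Big],$$ where the conditional expectations of the nonnegative random variables $(\cdots)_+$ are understood in the extended sense, with values in $[0,\infty]$. Then the system has a solution $(h^\S,w^\S)$, and it is unique up to $\mathbb P$-a.s. equality among all pairs of real-valued $\mathcal F_t$-measurable random variables. For this solution the random variable $(\cdots)_+$ is integrable under both $\mathbb P$ and $\tilde{\mathbb P}$, and, $\mathbb P$-a.s., $$w^\S\ \ge\ \frac1\rho e^{-\int_t^T|\vartheta_v|^2dv}\Big(\rho c-\rho xe^{\int_t^Tr_vdv}+\tilde{\mathbb E}[\zeta|\mathcal F_t]\Big).$$ -/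

import Mathlib

open MeasureTheory ProbabilityTheory Filter Topology Set

noncomputable section

/-- `W` is a one-dimensional standard Brownian motion on the time interval `[0, T]`:
it starts at `0`, has almost surely continuous paths, and for `0 ≤ s ≤ u ≤ T` the increment
`W u - W s` is centred Gaussian with variance `u - s` and independent of `σ(W v : 0 ≤ v ≤ s)`. -/
structure IsBrownianMotionOn {Ω : Type*} [mΩ : MeasurableSpace Ω] (P : Measure Ω) (T : ℝ)
    (W : ℝ → Ω → ℝ) : Prop where
  measurable : ∀ s ∈ Icc (0 : ℝ) T, Measurable (W s)
  zero : ∀ᵐ ω ∂P, W 0 ω = 0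
  continuous : ∀ᵐ ω ∂P, ContinuousOn (fun s => W s ω) (Icc (0 : ℝ) T)
  gaussian : ∀ s u : ℝ, 0 ≤ s → s ≤ u → u ≤ T →
    HasLaw (fun ω => W u ω - W s ω) (gaussianReal 0 (Real.toNNReal (u - s))) P
  indep : ∀ s u : ℝ, 0 ≤ s → s ≤ u → u ≤ T →
    Indep (⨆ v ∈ Icc (0 : ℝ) s, MeasurableSpace.comap (W v) inferInstance)
      (MeasurableSpace.comap (fun ω => W u ω - W s ω) inferInstance) P

/-- The `P`-completion of `σ(W u : 0 ≤ u ≤ s)`: the null sets of `P` are adjoined. -/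
def completedPast {Ω : Type*} [mΩ : MeasurableSpace Ω] (P : Measure Ω) (W : ℝ → Ω → ℝ) (s : ℝ) :
    MeasurableSpace Ω :=
  (⨆ u ∈ Icc (0 : ℝ) s, MeasurableSpace.comap (W u) inferInstance) ⊔
    MeasurableSpace.generateFrom {A : Set Ω | P A = 0}

/-- The right-continuous, completed natural filtration `(𝓕 t)` of `W` on `[0, T]`:
`𝓕 t` is the intersection of the completed pasts at the times `s ∈ (t, T]` when `t < T`,
and `𝓕 T` is the completed past at time `T`. -/
def brownianFiltration {Ω : Type*} [mΩ : MeasurableSpace Ω] (P : Measure Ω) (T : ℝ)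
    (W : ℝ → Ω → ℝ) (t : ℝ) : MeasurableSpace Ω :=
  ⨅ s ∈ Ioi t, completedPast P W (min s T)

/-- On a complete space the filtration consists of sub-σ-algebras of the ambient one. -/
theorem brownianFiltration_le {Ω : Type*} [mΩ : MeasurableSpace Ω] {P : Measure Ω}
    [P.IsComplete] {T : ℝ} {W : ℝ → Ω → ℝ} (hW : IsBrownianMotionOn P T W) (t : ℝ) :
    brownianFiltration P T W t ≤ mΩ := by
  refine (iInf₂_le (t + 1) (show t < t + 1 by linarith)).trans (sup_le ?_ ?_)
  · refine iSup₂_le fun u hu => ?_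
    exact (hW.measurable u ⟨hu.1, hu.2.trans (min_le_right _ _)⟩).comap_le
  · exact MeasurableSpace.generateFrom_le fun A hA => Measure.IsComplete.out' A hA

/-- The `n`-th left-endpoint Riemann–Itô sum of the deterministic integrand `f` against `W` over
`[0, t]`, for the uniform partition with `n` intervals. -/
def itoSum {Ω : Type*} (W : ℝ → Ω → ℝ) (f : ℝ → ℝ) (t : ℝ) (n : ℕ) (ω : Ω) : ℝ :=
  ∑ k ∈ Finset.range n,
    f ((k : ℝ) * t / n) * (W (((k : ℝ) + 1) * t / n) ω - W ((k : ℝ) * t / n) ω)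

/-- `I` is the `L²(P)` limit of the Riemann–Itô sums of `f` over `[0, t]`. -/
def IsWienerIntegral {Ω : Type*} [mΩ : MeasurableSpace Ω] (P : Measure Ω) (W : ℝ → Ω → ℝ)
    (f : ℝ → ℝ) (t : ℝ) (I : Ω → ℝ) : Prop :=
  MemLp I 2 P ∧ Tendsto (fun n : ℕ => eLpNorm (itoSum W f t n - I) 2 P) atTop (𝓝 0)

open Classical in
/-- The Itô integral `∫_0^t f dW` of a deterministic continuous integrand, as the `L²(P)` limit of
the Riemann–Itô sums. For `W` a Brownian motion on `[0, T]`, `t ∈ [0, T]` and `f` continuous on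
`[0, T]` the limit exists and is unique up to almost sure equality; any version of it may be
chosen. -/
def wienerIntegral {Ω : Type*} [mΩ : MeasurableSpace Ω] (P : Measure Ω) (W : ℝ → Ω → ℝ)
    (f : ℝ → ℝ) (t : ℝ) : Ω → ℝ :=
  if hI : ∃ I : Ω → ℝ, IsWienerIntegral P W f t I then hI.choose else 0

/-- The density process
`Λ t = exp (- ∫_0^t ϑ dW - (1/2) ∫_0^t |ϑ v|² dv)`. -/
def densityProcess {Ω : Type*} [mΩ : MeasurableSpace Ω] (P : Measure Ω) (W : ℝ → Ω → ℝ)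
    (ϑ : ℝ → ℝ) (t : ℝ) (ω : Ω) : ℝ :=
  Real.exp (-wienerIntegral P W ϑ t ω - 1 / 2 * ∫ v in (0 : ℝ)..t, |ϑ v| ^ 2)

/-- The risk-neutral measure, with density `Λ T` with respect to `P`. -/
def riskNeutralMeasure {Ω : Type*} [mΩ : MeasurableSpace Ω] (P : Measure Ω) (T : ℝ)
    (W : ℝ → Ω → ℝ) (ϑ : ℝ → ℝ) : Measure Ω :=
  P.withDensity fun ω => ENNReal.ofReal (densityProcess P W ϑ T ω)

/-- `κ = 1 - E[ζ]`. -/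
def kappa {Ω : Type*} [mΩ : MeasurableSpace Ω] (P : Measure Ω) (ζ : Ω → ℝ) : ℝ :=
  1 - ∫ ω, ζ ω ∂P

/-- The random variable `(h / κ - c - (θ + ρ) / (θ ρ) ζ + w Λ_T / Λ_t)₊`. -/
def embeddingPayoff {Ω : Type*} [mΩ : MeasurableSpace Ω] (P : Measure Ω) (T : ℝ)
    (W : ℝ → Ω → ℝ) (ϑ : ℝ → ℝ) (ζ : Ω → ℝ) (θ ρ c t : ℝ) (h w : Ω → ℝ) (ω : Ω) : ℝ :=
  max (h ω / kappa P ζ - c - (θ + ρ) / (θ * ρ) * ζ ω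
    + w ω * (densityProcess P W ϑ T ω / densityProcess P W ϑ t ω)) 0

/-- The pair `(h, w)` of `𝓕 t`-measurable real random variables solves the embedding–duality
system. The conditional expectation of a nonnegative random variable given `𝓕 t` is taken in the
usual extended sense, with values in `[0, ∞]` (`P⁻[ · | 𝓕 t]`), so no integrability of the payoff
has to be imposed on the candidates `(h, w)`; the equations are equalities in `[-∞, ∞]` between a
real number and a possibly infinite one, and force the conditional expectations to be finite. -/
structure IsEmbeddingDualitySolution {Ω : Type*} [mΩ : MeasurableSpace Ω] (P : Measure Ω) (T : ℝ)
    (W : ℝ → Ω → ℝ) (r ϑ : ℝ → ℝ) (ζ : Ω → ℝ) (θ ρ c x t z : ℝ) (h w : Ω → ℝ) : Prop where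
  measurable_h : Measurable[brownianFiltration P T W t] h
  measurable_w : Measurable[brownianFiltration P T W t] w
  first_eq : ∀ᵐ ω ∂P,
    ((kappa P ζ * z : ℝ) : EReal) =
      ((θ * ρ / (θ + ρ) : ℝ) : EReal) *
        ((P⁻[fun ω' => ENNReal.ofReal (embeddingPayoff P T W ϑ ζ θ ρ c t h w ω') |
          brownianFiltration P T W t] ω : ENNReal) : EReal)
  second_eq : ∀ᵐ ω ∂P,
    ((w ω * ρ * Real.exp (∫ v in t..T, |ϑ v| ^ 2)
        - ρ * (c - x * Real.exp (∫ v in t..T, r v))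
        - ((riskNeutralMeasure P T W ϑ)[ζ | brownianFiltration P T W t]) ω : ℝ) : EReal) =
      ((θ * ρ / (θ + ρ) : ℝ) : EReal) *
        (((riskNeutralMeasure P T W ϑ)⁻[fun ω' =>
            ENNReal.ofReal (embeddingPayoff P T W ϑ ζ θ ρ c t h w ω') |
          brownianFiltration P T W t] ω : ENNReal) : EReal)

end

open MeasureTheory ProbabilityTheory Filter Topology Set

noncomputable section

/-! Condition on `𝓕 t`. Put `Z = Λ_T / Λ_t`, `Y = c + (θ + ρ) / (θ ρ) ζ`, `η = h / κ`, `a = θ ρ / (θ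
+ ρ) < ρ` and `m = exp (∫_t^T |ϑ|²)`. By Bayes' formula a conditional expectation under the
risk-neutral measure is the conditional `P`-expectation weighted by `Z`. Given the conditional law
`μ` of `(Z, Y)`, the system is therefore, for almost every `ω`, a system for two real numbers: `∫ (η
- y + w z)₊ dμ = k` and `ρ m w - a ∫ z (η - y + w z)₊ dμ = b`, with `k = κ z / a > 0` for the `z` of
the theorem. All that is needed of `μ` is that `z ≥ 0` has mean `1` and second moment at most `m`,
that `y` is square integrable, and that `y ≥ c`.

For each `w` the first equation fixes `η`. Along this curve the weighted mean `q = ∫ z (η - y + w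
z)₊ dμ` is nondecreasing and `m`-Lipschitz in `w`
(`IsAdmissibleLaw.integral_fst_mul_affinePayoff_sub`). Hence `w ↦ (a q + b) / (ρ m)` contracts with
ratio `a / ρ < 1`, which gives existence, and `ρ m w - a q` increases with slope at least `(ρ - a)
m`, which gives uniqueness, measurable dependence on `ω` and a linear bound on `|w|`. This bound
yields integrability under the risk-neutral measure; the lower bound on `w` says only that the right
side of the second equation is nonnegative.

The stochastic input is that `Z` has conditional moments `1` and `m`
(`setLIntegral_densityProcess_div_pow_of_brownianFiltration`). It holds because the increment of the
Wiener integral over `[t, T]` is Gaussian and independent of `𝓕 t` (`map_restrict_wienerIntegral`).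
-/

theorem eLpNorm_two_eq_sqrt_integral_sq {α : Type*} [MeasurableSpace α] {μ : Measure α}
    {f : α → ℝ} (hf : MemLp f 2 μ) :
    eLpNorm f 2 μ = ENNReal.ofReal (√(∫ x, f x ^ 2 ∂μ)) := by
  rw [hf.eLpNorm_eq_integral_rpow_norm (by norm_num) (by norm_num), Real.sqrt_eq_rpow]
  simp

/-! ### Second moments of Brownian increments -/

namespace IsBrownianMotionOn

variable {Ω : Type*} [mΩ : MeasurableSpace Ω] {P : Measure Ω} {T : ℝ} {W : ℝ → Ω → ℝ}

theorem memLp_increment (hW : IsBrownianMotionOn P T W) {s u : ℝ} (hs : 0 ≤ s) (hsu : s ≤ u)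
    (hu : u ≤ T) : MemLp (fun ω => W u ω - W s ω) 2 P := by
  have h := hW.gaussian s u hs hsu hu
  have := memLp_id_gaussianReal (μ := 0) (v := Real.toNNReal (u - s)) 2
  rw [← h.map_eq] at this
  exact (memLp_map_measure_iff (by fun_prop) h.aemeasurable).1 this

theorem integral_increment (hW : IsBrownianMotionOn P T W) {s u : ℝ} (hs : 0 ≤ s) (hsu : s ≤ u)
    (hu : u ≤ T) : ∫ ω, (W u ω - W s ω) ∂P = 0 := by
  rw [(hW.gaussian s u hs hsu hu).integral_eq, integral_id_gaussianReal]

theorem integral_increment_sq (hW : IsBrownianMotionOn P T W) {s u : ℝ} (hs : 0 ≤ s)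
    (hsu : s ≤ u) (hu : u ≤ T) : ∫ ω, (W u ω - W s ω) ^ 2 ∂P = u - s := by
  have h := (hW.gaussian s u hs hsu hu).integral_comp (f := fun x : ℝ => x ^ 2)
    (by fun_prop)
  have h2 := variance_id_gaussianReal (μ := 0) (v := Real.toNNReal (u - s))
  rw [variance_of_integral_eq_zero (by fun_prop) (by simp)] at h2
  simp only [Function.comp_def] at h
  rw [h]
  simp only [id] at h2
  rw [h2, Real.coe_toNNReal _ (by linarith)]

theorem memLp_two (hW : IsBrownianMotionOn P T W) {s : ℝ} (hs : s ∈ Icc 0 T) :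
    MemLp (W s) 2 P := by
  refine (hW.memLp_increment le_rfl hs.1 hs.2).ae_eq ?_
  filter_upwards [hW.zero] with ω h
  simp [h]

theorem integral_mul_increment (hW : IsBrownianMotionOn P T W) {s u : ℝ} (hs : 0 ≤ s)
    (hsu : s ≤ u) (hu : u ≤ T) : ∫ ω, W s ω * (W u ω - W s ω) ∂P = 0 := by
  have hind : IndepFun (W s) (fun ω => W u ω - W s ω) P := by
    rw [IndepFun_iff_Indep]
    exact indep_of_indep_of_le_left (hW.indep s u hs hsu hu)
      (le_iSup₂_of_le s ⟨hs, le_rfl⟩ le_rfl)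
  rw [hind.integral_fun_mul_eq_mul_integral (hW.memLp_two ⟨hs, hsu.trans hu⟩).1
    (hW.memLp_increment hs hsu hu).1, hW.integral_increment hs hsu hu, mul_zero]

theorem integral_sq (hW : IsBrownianMotionOn P T W) {s : ℝ} (hs : s ∈ Icc 0 T) :
    ∫ ω, W s ω ^ 2 ∂P = s := by
  refine Eq.trans (integral_congr_ae ?_)
    ((hW.integral_increment_sq le_rfl hs.1 hs.2).trans (sub_zero s))
  filter_upwards [hW.zero] with ω h
  simp [h]

theorem integral_mul_of_le (hW : IsBrownianMotionOn P T W) {s u : ℝ} (hs : 0 ≤ s)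
    (hsu : s ≤ u) (hu : u ≤ T) : ∫ ω, W s ω * W u ω ∂P = s := by
  have hs' := hW.memLp_two (s := s) ⟨hs, hsu.trans hu⟩
  calc ∫ ω, W s ω * W u ω ∂P = ∫ ω, (W s ω ^ 2 + W s ω * (W u ω - W s ω)) ∂P := by
        congr 1; ext ω; ring
    _ = s := by
      have hI : Integrable (fun ω => W s ω * (W u ω - W s ω)) P :=
        hs'.integrable_mul (hW.memLp_increment hs hsu hu)
      rw [integral_add hs'.integrable_sq hI, hW.integral_sq ⟨hs, hsu.trans hu⟩, hW.integral_mul_increment hs hsu hu, add_zero]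

theorem integral_mul (hW : IsBrownianMotionOn P T W) {s u : ℝ} (hs : s ∈ Icc 0 T)
    (hu : u ∈ Icc 0 T) : ∫ ω, W s ω * W u ω ∂P = min s u := by
  rcases le_total s u with h | h
  · rw [hW.integral_mul_of_le hs.1 h hu.2, min_eq_left h]
  · rw [min_eq_right h]
    simpa only [mul_comm] using hW.integral_mul_of_le hu.1 h hs.2

/-- This is the Itô isometry on generators. Allowing the two intervals to overlap arbitrarily
removes any need for common refinements of partitions. -/
theorem integral_increment_mul_increment (hW : IsBrownianMotionOn P T W) {a b c d : ℝ}
    (ha : 0 ≤ a) (hab : a ≤ b) (hb : b ≤ T) (hc : 0 ≤ c) (hcd : c ≤ d) (hd : d ≤ T) :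
    ∫ ω, (W b ω - W a ω) * (W d ω - W c ω) ∂P =
      ∫ v, (Ioc a b).indicator 1 v * (Ioc c d).indicator (1 : ℝ → ℝ) v := by
  have Ha : a ∈ Icc 0 T := ⟨ha, hab.trans hb⟩
  have Hb : b ∈ Icc 0 T := ⟨ha.trans hab, hb⟩
  have Hc : c ∈ Icc 0 T := ⟨hc, hcd.trans hd⟩
  have Hd : d ∈ Icc 0 T := ⟨hc.trans hcd, hd⟩
  have I : ∀ {s u}, s ∈ Icc 0 T → u ∈ Icc 0 T → Integrable (fun ω => W s ω * W u ω) P :=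
    fun hs hu => (hW.memLp_two hs).integrable_mul (hW.memLp_two hu)
  have h1 : ∫ ω, (W b ω - W a ω) * (W d ω - W c ω) ∂P
      = (min b d - min b c) - (min a d - min a c) := by
    have I1 : Integrable (fun ω => W b ω * W d ω - W b ω * W c ω) P := (I Hb Hd).sub (I Hb Hc)
    have I2 : Integrable (fun ω => W a ω * W d ω - W a ω * W c ω) P := (I Ha Hd).sub (I Ha Hc)
    rw [← hW.integral_mul Hb Hd, ← hW.integral_mul Hb Hc, ← hW.integral_mul Ha Hd,
      ← hW.integral_mul Ha Hc, ← integral_sub (I Hb Hd) (I Hb Hc),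
      ← integral_sub (I Ha Hd) (I Ha Hc), ← integral_sub I1 I2]
    congr 1; ext ω; ring
  have h2 : (fun v => (Ioc a b).indicator 1 v * (Ioc c d).indicator (1 : ℝ → ℝ) v)
      = (Ioc (max a c) (min b d)).indicator 1 := by
    ext v
    rw [← Ioc_inter_Ioc]
    by_cases h : v ∈ Ioc a b <;> by_cases h' : v ∈ Ioc c d <;> simp [indicator, h, h']
  rw [h1, h2, integral_indicator_one measurableSet_Ioc, Measure.real, Real.volume_Ioc,
    ENNReal.toReal_ofReal']
  grind

end IsBrownianMotionOn

/-! ### Integrals of step functions and the Itô isometry -/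

/-- `X` is the Wiener integral over `[0, T]` of the step function `g`. -/
def IsElementaryIntegral {Ω : Type*} (T : ℝ) (W : ℝ → Ω → ℝ) (X : Ω → ℝ) (g : ℝ → ℝ) : Prop :=
  ∃ (ι : Type) (_ : Fintype ι) (c a b : ι → ℝ), (∀ i, 0 ≤ a i ∧ a i ≤ b i ∧ b i ≤ T) ∧
    X = (fun ω => ∑ i, c i * (W (b i) ω - W (a i) ω)) ∧
    g = fun v => ∑ i, c i * (Ioc (a i) (b i)).indicator 1 v

namespace IsElementaryIntegral

variable {Ω : Type*} {T : ℝ} {W : ℝ → Ω → ℝ} {X Y : Ω → ℝ} {g k : ℝ → ℝ}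

/-- Closure under differences lets the isometry compare sums over unrelated partitions; the disjoint
union of the index types suffices because intervals may overlap. -/
theorem sub (hX : IsElementaryIntegral T W X g) (hY : IsElementaryIntegral T W Y k) :
    IsElementaryIntegral T W (X - Y) (g - k) := by
  obtain ⟨ι, _, c, a, b, h, rfl, rfl⟩ := hX
  obtain ⟨ι', _, c', a', b', h', rfl, rfl⟩ := hY
  refine ⟨ι ⊕ ι', inferInstance, Sum.elim c (fun i => - c' i), Sum.elim a a', Sum.elim b b', ?_,
    ?_, ?_⟩
  · rintro (i | i)
    · exact h i
    · exact h' i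
  · ext ω
    simp [Fintype.sum_sum_type, sub_eq_add_neg]
  · ext ω
    simp [Fintype.sum_sum_type, sub_eq_add_neg]

theorem memLp_left [MeasurableSpace Ω] {P : Measure Ω} (hW : IsBrownianMotionOn P T W) (hX : IsElementaryIntegral T W X g) :
    MemLp X 2 P := by
  obtain ⟨ι, _, c, a, b, h, rfl, rfl⟩ := hX
  exact memLp_finsetSum _ fun i _ =>
    (hW.memLp_increment (h i).1 (h i).2.1 (h i).2.2).const_mul (c i)

theorem memLp_indicator_Ioc (a b : ℝ) (p : ENNReal) :
    MemLp ((Ioc a b).indicator (1 : ℝ → ℝ)) p volume :=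
  memLp_indicator_const p measurableSet_Ioc 1 (Or.inr (by simp))

theorem memLp_right (hX : IsElementaryIntegral T W X g) : MemLp g 2 volume := by
  obtain ⟨ι, _, c, a, b, h, rfl, rfl⟩ := hX
  exact memLp_finsetSum _ fun i _ => (memLp_indicator_Ioc _ _ _).const_mul (c i)

theorem integral_sq_eq [MeasurableSpace Ω] {P : Measure Ω} (hW : IsBrownianMotionOn P T W) (hX : IsElementaryIntegral T W X g) :
    ∫ ω, X ω ^ 2 ∂P = ∫ v, g v ^ 2 := by
  obtain ⟨ι, _, c, a, b, h, rfl, rfl⟩ := hX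
  have hL : ∀ i, MemLp (fun ω => c i * (W (b i) ω - W (a i) ω)) 2 P := fun i =>
    (hW.memLp_increment (h i).1 (h i).2.1 (h i).2.2).const_mul (c i)
  have hR : ∀ i, MemLp (fun v => c i * (Ioc (a i) (b i)).indicator (1 : ℝ → ℝ) v) 2 volume :=
    fun i => (memLp_indicator_Ioc _ _ _).const_mul (c i)
  have hL2 : ∀ i j, Integrable (fun ω => (c i * (W (b i) ω - W (a i) ω)) *
      (c j * (W (b j) ω - W (a j) ω))) P := fun i j => (hL i).integrable_mul (hL j)
  have hR2 : ∀ i j, Integrable (fun v => (c i * (Ioc (a i) (b i)).indicator (1 : ℝ → ℝ) v) *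
      (c j * (Ioc (a j) (b j)).indicator (1 : ℝ → ℝ) v)) :=
    fun i j => (hR i).integrable_mul (hR j)
  simp only [sq, Finset.sum_mul_sum]
  rw [integral_finsetSum _ fun i _ => integrable_finsetSum _ fun j _ => hL2 i j,
    integral_finsetSum _ fun i _ => integrable_finsetSum _ fun j _ => hR2 i j]
  refine Finset.sum_congr rfl fun i _ => ?_
  rw [integral_finsetSum _ fun j _ => hL2 i j, integral_finsetSum _ fun j _ => hR2 i j]
  refine Finset.sum_congr rfl fun j _ => ?_
  have := hW.integral_increment_mul_increment (h i).1 (h i).2.1 (h i).2.2 (h j).1 (h j).2.1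
    (h j).2.2
  simp only [mul_mul_mul_comm (c i)]
  rw [integral_const_mul, integral_const_mul, this]

theorem eLpNorm_eq [MeasurableSpace Ω] {P : Measure Ω} (hW : IsBrownianMotionOn P T W) (hX : IsElementaryIntegral T W X g) :
    eLpNorm X 2 P = eLpNorm g 2 volume := by
  rw [eLpNorm_two_eq_sqrt_integral_sq (hX.memLp_left hW),
    eLpNorm_two_eq_sqrt_integral_sq hX.memLp_right, hX.integral_sq_eq hW]

end IsElementaryIntegral

/-! ### Riemann–Itô sums and convergence of their step functions -/

/-- The `k`-th point of the uniform partition of `[a, b]` into `n` intervals. -/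
def uniformPoint (a b : ℝ) (n k : ℕ) : ℝ := a + k * (b - a) / n

/-- The left-endpoint Riemann–Itô sum of `f` for the uniform partition of `[a, b]`. -/
def itoSumOn {Ω : Type*} (W : ℝ → Ω → ℝ) (f : ℝ → ℝ) (a b : ℝ) (n : ℕ) (ω : Ω) : ℝ :=
  ∑ k ∈ Finset.range n, f (uniformPoint a b n k) *
    (W (uniformPoint a b n (k + 1)) ω - W (uniformPoint a b n k) ω)

/-- The left-endpoint step function of `f` for the uniform partition of `[a, b]`. -/
def leftStep (f : ℝ → ℝ) (a b : ℝ) (n : ℕ) (v : ℝ) : ℝ :=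
  ∑ k ∈ Finset.range n, f (uniformPoint a b n k) *
    (Ioc (uniformPoint a b n k) (uniformPoint a b n (k + 1))).indicator 1 v

theorem itoSum_eq_itoSumOn {Ω : Type*} (W : ℝ → Ω → ℝ) (f : ℝ → ℝ) (t : ℝ) (n : ℕ) :
    itoSum W f t n = itoSumOn W f 0 t n := by
  ext ω
  simp [itoSum, itoSumOn, uniformPoint]

theorem uniformPoint_zero (a b : ℝ) (n : ℕ) : uniformPoint a b n 0 = a := by
  simp [uniformPoint]

theorem uniformPoint_self (a b : ℝ) {n : ℕ} (hn : n ≠ 0) : uniformPoint a b n n = b := by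
  have : (n : ℝ) ≠ 0 := by exact_mod_cast hn
  simp only [uniformPoint]
  field_simp
  ring

theorem uniformPoint_mono {a b : ℝ} (hab : a ≤ b) (n : ℕ) : Monotone (uniformPoint a b n) := by
  intro k l hkl
  have : (k : ℝ) ≤ l := by exact_mod_cast hkl
  have : 0 ≤ b - a := by linarith
  simp only [uniformPoint]
  gcongr

theorem uniformPoint_mem {a b : ℝ} (hab : a ≤ b) {n k : ℕ} (hk : k ≤ n) :
    uniformPoint a b n k ∈ Icc a b := by
  rcases Nat.eq_zero_or_pos n with rfl | hn
  · simp [uniformPoint, hab]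
  · exact ⟨(uniformPoint_zero a b n).symm.le.trans (uniformPoint_mono hab n (Nat.zero_le k)),
      (uniformPoint_mono hab n hk).trans (uniformPoint_self a b hn.ne').le⟩

theorem isElementaryIntegral_itoSumOn {Ω : Type*} {T : ℝ} (W : ℝ → Ω → ℝ) (f : ℝ → ℝ) {a b : ℝ}
    (ha : 0 ≤ a) (hab : a ≤ b) (hb : b ≤ T) (n : ℕ) :
    IsElementaryIntegral T W (itoSumOn W f a b n) (leftStep f a b n) := by
  refine ⟨Fin n, inferInstance, fun k => f (uniformPoint a b n k), fun k => uniformPoint a b n k,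
    fun k => uniformPoint a b n (k + 1), fun k => ⟨?_, ?_, ?_⟩, ?_, ?_⟩
  · exact ha.trans (uniformPoint_mem hab k.2.le).1
  · exact uniformPoint_mono hab n (Nat.le_succ _)
  · exact (uniformPoint_mem hab k.2).2.trans hb
  · ext ω
    rw [itoSumOn, Finset.sum_range]
  · ext v
    rw [leftStep, Finset.sum_range]

/-- At each point, at most one interval of a partition contributes to a step function. -/
theorem sum_indicator_Ioc_eq {l : ℕ → ℝ} (hl : Monotone l) (n : ℕ) (v : ℝ) :
    (v ∈ Ioc (l 0) (l n) ∧ ∃ k < n, v ∈ Ioc (l k) (l (k + 1)) ∧ ∀ c : ℕ → ℝ,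
      ∑ j ∈ Finset.range n, c j * (Ioc (l j) (l (j + 1))).indicator (1 : ℝ → ℝ) v = c k) ∨
    (v ∉ Ioc (l 0) (l n) ∧ ∀ c : ℕ → ℝ,
      ∑ j ∈ Finset.range n, c j * (Ioc (l j) (l (j + 1))).indicator (1 : ℝ → ℝ) v = 0) := by
  induction n with
  | zero => right; simp
  | succ n ih =>
    have h0 := hl (Nat.zero_le n)
    have h1 := hl (Nat.le_succ n)
    simp only [Finset.sum_range_succ]
    rcases ih with ⟨hv, k, hk, hvk, h⟩ | ⟨hv, h⟩
    · left
      refine ⟨⟨hv.1, hv.2.trans h1⟩, k, by omega, hvk, fun c => ?_⟩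
      rw [h, indicator_of_notMem (fun h' => absurd h'.1 (not_lt.2 hv.2))]
      simp
    · by_cases hvn : v ∈ Ioc (l n) (l (n + 1))
      · left
        refine ⟨⟨h0.trans_lt hvn.1, hvn.2⟩, n, by omega, hvn, fun c => ?_⟩
        rw [h, indicator_of_mem hvn]
        simp
      · right
        refine ⟨fun hv' => ?_, fun c => ?_⟩
        · by_cases h2 : v ≤ l n
          · exact hv ⟨hv'.1, h2⟩
          · exact hvn ⟨not_le.1 h2, hv'.2⟩
        · rw [h, indicator_of_notMem hvn]
          simp

theorem leftStep_of_mem {f : ℝ → ℝ} {a b : ℝ} (hab : a ≤ b) {n : ℕ} (hn : n ≠ 0) {v : ℝ}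
    (hv : v ∈ Ioc a b) :
    ∃ p ∈ Icc a b, |p - v| ≤ (b - a) / n ∧ leftStep f a b n v = f p := by
  rcases sum_indicator_Ioc_eq (uniformPoint_mono hab n) n v with ⟨_, k, hk, hvk, h⟩ | ⟨hv', _⟩
  · refine ⟨_, uniformPoint_mem hab hk.le, ?_, h _⟩
    have : uniformPoint a b n (k + 1) = uniformPoint a b n k + (b - a) / n := by
      simp only [uniformPoint]; push_cast; ring
    rw [this] at hvk
    rw [abs_le]
    constructor <;> linarith [hvk.1, hvk.2]
  · rw [uniformPoint_zero, uniformPoint_self a b hn] at hv'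
    exact absurd hv hv'

theorem leftStep_of_notMem {f : ℝ → ℝ} {a b : ℝ} (hab : a ≤ b) {n : ℕ} {v : ℝ}
    (hv : v ∉ Ioc a b) : leftStep f a b n v = 0 := by
  rcases sum_indicator_Ioc_eq (uniformPoint_mono hab n) n v with ⟨hv', _⟩ | ⟨_, h⟩
  · refine absurd ?_ hv
    rw [uniformPoint_zero] at hv'
    exact ⟨hv'.1, hv'.2.trans (uniformPoint_mem hab le_rfl).2⟩
  · exact h _

/-- The intervals are disjoint, so no cross terms survive the square. -/
theorem integral_sum_indicator_Ioc_sq {l : ℕ → ℝ} (hl : Monotone l) (n : ℕ) (c : ℕ → ℝ) :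
    ∫ v, (∑ j ∈ Finset.range n, c j * (Ioc (l j) (l (j + 1))).indicator (1 : ℝ → ℝ) v) ^ 2
      = ∑ j ∈ Finset.range n, c j ^ 2 * (l (j + 1) - l j) := by
  have : ∀ v, (∑ j ∈ Finset.range n, c j * (Ioc (l j) (l (j + 1))).indicator (1 : ℝ → ℝ) v) ^ 2
      = ∑ j ∈ Finset.range n, c j ^ 2 * (Ioc (l j) (l (j + 1))).indicator (1 : ℝ → ℝ) v := by
    intro v
    rcases sum_indicator_Ioc_eq hl n v with ⟨_, k, hk, hvk, h⟩ | ⟨_, h⟩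
    · rw [h, h fun j => c j ^ 2]
    · rw [h, h fun j => c j ^ 2]; simp
  simp only [this]
  rw [integral_finsetSum _ fun j _ => (memLp_one_iff_integrable.1
    (IsElementaryIntegral.memLp_indicator_Ioc _ _ _)).const_mul _]
  refine Finset.sum_congr rfl fun j _ => ?_
  rw [integral_const_mul, integral_indicator_one measurableSet_Ioc, Measure.real,
    Real.volume_Ioc, ENNReal.toReal_ofReal (sub_nonneg.2 (hl (Nat.le_succ j)))]

section leftStep

variable {f : ℝ → ℝ} {T a b : ℝ} {s : ℕ → ℝ}

theorem measurable_leftStep : ∀ (a b : ℝ) (n : ℕ), Measurable (leftStep f a b n) := by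
  intro a b n
  unfold leftStep
  refine Finset.measurable_sum _ fun k _ => Measurable.const_mul ?_ _
  exact measurable_one.indicator measurableSet_Ioc

theorem norm_leftStep_le {M : ℝ} (hM : ∀ v ∈ Icc 0 T, |f v| ≤ M) (ha : 0 ≤ a) (hab : a ≤ b)
    (hb : b ≤ T) (n : ℕ) (v : ℝ) : |leftStep f a b n v| ≤ (Ioc 0 T).indicator (fun _ => M) v := by
  have hM0 : 0 ≤ M := (abs_nonneg _).trans (hM 0 ⟨le_rfl, ha.trans (hab.trans hb)⟩)
  by_cases hv : v ∈ Ioc a b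
  · rw [indicator_of_mem (show v ∈ Ioc 0 T from ⟨ha.trans_lt hv.1, hv.2.trans hb⟩)]
    rcases Nat.eq_zero_or_pos n with rfl | hn
    · simpa [leftStep] using hM0
    · obtain ⟨p, hp, -, h⟩ := leftStep_of_mem (f := f) hab hn.ne' hv
      rw [h]
      exact hM p ⟨ha.trans hp.1, hp.2.trans hb⟩
  · rw [leftStep_of_notMem hab hv, abs_zero]
    exact indicator_nonneg (fun _ _ => hM0) v

/-- The left end `s n` of the partition may move towards `a`. This is what later handles the
right-continuous filtration, whose sets at time `a` are known only to lie in the completed pasts at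
times `s n > a`. -/
theorem tendsto_leftStep (hf : ContinuousOn f (Icc 0 T)) (ha : 0 ≤ a) (hb : b ≤ T)
    (hs : ∀ n, a ≤ s n ∧ s n ≤ b) (hlim : Tendsto s atTop (𝓝 a)) (v : ℝ) :
    Tendsto (fun n => leftStep f (s n) b n v) atTop (𝓝 ((Ioc a b).indicator f v)) := by
  by_cases hv : v ∈ Ioc a b
  · rw [indicator_of_mem hv]
    have hev : ∀ᶠ n in atTop, ∃ p ∈ Icc (s n) b, |p - v| ≤ (b - a) / n ∧
        leftStep f (s n) b n v = f p := by
      filter_upwards [hlim.eventually_lt_const hv.1, eventually_ne_atTop 0] with n h1 h2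
      obtain ⟨p, hp, hpv, h⟩ := leftStep_of_mem (f := f) (hs n).2 h2 ⟨h1, hv.2⟩
      refine ⟨p, hp, hpv.trans ?_, h⟩
      gcongr
      exact (hs n).1
    have hc : ContinuousWithinAt f (Icc 0 T) v := hf v ⟨ha.trans hv.1.le, hv.2.trans hb⟩
    rw [Metric.continuousWithinAt_iff] at hc
    rw [Metric.tendsto_atTop']
    intro ε hε
    obtain ⟨δ, hδ, H⟩ := hc ε hε
    have hd : Tendsto (fun n : ℕ => (b - a) / n) atTop (𝓝 0) :=
      tendsto_const_div_atTop_nhds_zero_nat _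
    obtain ⟨N, hN⟩ := eventually_atTop.1 (hev.and (hd.eventually_lt_const hδ))
    refine ⟨N, fun n hn => ?_⟩
    obtain ⟨⟨p, hp, hpv, h⟩, hlt⟩ := hN n hn.le
    rw [h]
    refine H ⟨ha.trans ((hs n).1.trans hp.1), hp.2.trans hb⟩ ?_
    rw [Real.dist_eq]
    exact hpv.trans_lt hlt
  · rw [indicator_of_notMem hv]
    refine tendsto_const_nhds.congr fun n => (leftStep_of_notMem (hs n).2 ?_).symm
    exact fun h => hv ⟨(hs n).1.trans_lt h.1, h.2⟩

theorem norm_indicator_le {M : ℝ} (hM : ∀ v ∈ Icc 0 T, |f v| ≤ M) (ha : 0 ≤ a) (hab : a ≤ b)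
    (hb : b ≤ T) (v : ℝ) : |(Ioc a b).indicator f v| ≤ (Ioc 0 T).indicator (fun _ => M) v := by
  have hM0 : 0 ≤ M := (abs_nonneg _).trans (hM 0 ⟨le_rfl, ha.trans (hab.trans hb)⟩)
  by_cases hv : v ∈ Ioc a b
  · have hv' : v ∈ Ioc 0 T := ⟨ha.trans_lt hv.1, hv.2.trans hb⟩
    rw [indicator_of_mem hv', indicator_of_mem hv]
    exact hM v ⟨hv'.1.le, hv'.2⟩
  · rw [indicator_of_notMem hv, abs_zero]
    exact indicator_nonneg (fun _ _ => hM0) v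

theorem aestronglyMeasurable_indicator_Ioc (hf : ContinuousOn f (Icc 0 T)) (ha : 0 ≤ a)
    (hb : b ≤ T) : AEStronglyMeasurable ((Ioc a b).indicator f) volume := by
  rw [aestronglyMeasurable_indicator_iff measurableSet_Ioc]
  exact (hf.mono fun v hv => ⟨ha.trans hv.1.le, hv.2.trans hb⟩).aestronglyMeasurable
    measurableSet_Ioc

theorem memLp_indicator_of_continuousOn (hf : ContinuousOn f (Icc 0 T)) (ha : 0 ≤ a)
    (hab : a ≤ b) (hb : b ≤ T) : MemLp ((Ioc a b).indicator f) 2 volume := by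
  obtain ⟨M, hM⟩ := isCompact_Icc.exists_bound_of_continuousOn hf
  refine (memLp_indicator_const 2 (measurableSet_Ioc (a := (0 : ℝ)) (b := T)) M
    (Or.inr (by simp))).mono (aestronglyMeasurable_indicator_Ioc hf ha hb) (ae_of_all _ fun v => ?_)
  exact (norm_indicator_le hM ha hab hb v).trans (le_abs_self _)

theorem tendsto_integral_leftStep_sq (hf : ContinuousOn f (Icc 0 T)) (ha : 0 ≤ a) (hab : a ≤ b)
    (hb : b ≤ T) (hs : ∀ n, a ≤ s n ∧ s n ≤ b) (hlim : Tendsto s atTop (𝓝 a)) :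
    Tendsto (fun n => ∫ v, leftStep f (s n) b n v ^ 2) atTop (𝓝 (∫ v in a..b, f v ^ 2)) := by
  obtain ⟨M, hM⟩ := isCompact_Icc.exists_bound_of_continuousOn hf
  rw [intervalIntegral.integral_of_le hab, ← integral_indicator measurableSet_Ioc]
  have : (Ioc a b).indicator (fun v => f v ^ 2) = fun v => (Ioc a b).indicator f v ^ 2 := by
    ext v; by_cases hv : v ∈ Ioc a b <;> simp [hv]
  rw [this]
  refine tendsto_integral_of_dominated_convergence
    (fun v => (Ioc 0 T).indicator (fun _ => M ^ 2) v) (fun n => ?_) ?_ (fun n => ?_) ?_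
  · exact ((measurable_leftStep _ _ _).pow_const 2).aestronglyMeasurable
  · exact (integrable_indicator_iff measurableSet_Ioc).2 (integrable_const _)
  · refine ae_of_all _ fun v => ?_
    have := norm_leftStep_le hM (ha.trans (hs n).1) (hs n).2 hb n v
    rw [norm_pow, Real.norm_eq_abs]
    by_cases hv : v ∈ Ioc 0 T
    · simp only [hv, indicator_of_mem] at this ⊢
      gcongr
    · simp only [hv, not_false_eq_true, indicator_of_notMem] at this ⊢
      simp [abs_nonpos_iff.1 this]
  · exact ae_of_all _ fun v => (tendsto_leftStep hf ha hb hs hlim v).pow 2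

theorem tendsto_eLpNorm_leftStep_sub (hf : ContinuousOn f (Icc 0 T)) (ha : 0 ≤ a) (hab : a ≤ b)
    (hb : b ≤ T) (hs : ∀ n, a ≤ s n ∧ s n ≤ b) (hlim : Tendsto s atTop (𝓝 a)) :
    Tendsto (fun n => eLpNorm (leftStep f (s n) b n - (Ioc a b).indicator f) 2 volume) atTop
      (𝓝 0) := by
  obtain ⟨M, hM⟩ := isCompact_Icc.exists_bound_of_continuousOn hf
  have hmem : ∀ n, MemLp (leftStep f (s n) b n - (Ioc a b).indicator f) 2 volume := fun n =>
    (isElementaryIntegral_itoSumOn (T := T) (Ω := ℝ) (fun _ _ => 0) f (ha.trans (hs n).1) (hs n).2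
      hb n).memLp_right.sub (memLp_indicator_of_continuousOn hf ha hab hb)
  simp only [fun n => eLpNorm_two_eq_sqrt_integral_sq (hmem n)]
  rw [← ENNReal.ofReal_zero, ← Real.sqrt_zero]
  refine ENNReal.tendsto_ofReal (Tendsto.sqrt ?_)
  rw [← integral_zero ℝ ℝ (μ := volume)]
  refine tendsto_integral_of_dominated_convergence
    (fun v => (Ioc 0 T).indicator (fun _ => (M + M) ^ 2) v) (fun n => ?_) ?_ (fun n => ?_) ?_
  · exact (hmem n).integrable_sq.1
  · exact (integrable_indicator_iff measurableSet_Ioc).2 (integrable_const _)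
  · refine ae_of_all _ fun v => ?_
    have h1 := norm_leftStep_le hM (ha.trans (hs n).1) (hs n).2 hb n v
    have h2 := norm_indicator_le hM ha hab hb v
    rw [norm_pow, Real.norm_eq_abs, Pi.sub_apply]
    have h3 := (abs_sub _ _).trans (add_le_add h1 h2)
    by_cases hv : v ∈ Ioc 0 T
    · simp only [hv, indicator_of_mem] at h3 ⊢
      gcongr
    · simp only [hv, not_false_eq_true, indicator_of_notMem, add_zero] at h3 ⊢
      simp [abs_nonpos_iff.1 h3]
  · refine ae_of_all _ fun v => ?_
    have := ((tendsto_leftStep hf ha hb hs hlim v).sub_const ((Ioc a b).indicator f v)).pow 2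
    simpa using this

end leftStep

/-! ### The Wiener integral and the conditional law of its increments -/

section WienerIntegral

variable {Ω : Type*} [mΩ : MeasurableSpace Ω] {P : Measure Ω} {T : ℝ} {W : ℝ → Ω → ℝ}
  {f : ℝ → ℝ}

/-- Sequences of elementary integrals converge in `L²` as soon as their step functions do. -/
theorem exists_limit_of_isElementaryIntegral (hW : IsBrownianMotionOn P T W) {X : ℕ → Ω → ℝ}
    {g : ℕ → ℝ → ℝ} {G : ℝ → ℝ} (hX : ∀ n, IsElementaryIntegral T W (X n) (g n))
    (hG : MemLp G 2 volume) (hlim : Tendsto (fun n => eLpNorm (g n - G) 2 volume) atTop (𝓝 0)) :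
    ∃ I : Ω → ℝ, MemLp I 2 P ∧ Tendsto (fun n => eLpNorm (X n - I) 2 P) atTop (𝓝 0) := by
  have hXm := fun n => (hX n).memLp_left hW
  have hgm := fun n => (hX n).memLp_right
  have h1 : CauchySeq fun n => (hgm n).toLp (g n) :=
    ((Lp.tendsto_Lp_iff_tendsto_eLpNorm'' g hgm G hG).2 hlim).cauchySeq
  -- The isometry applied to differences identifies `L²(P)` distances with `L²` distances of the
  -- step functions, so the Cauchy property transfers.
  have h2 : CauchySeq fun n => (hXm n).toLp (X n) := by
    rw [EMetric.cauchySeq_iff] at h1 ⊢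
    intro ε hε
    obtain ⟨N, hN⟩ := h1 ε hε
    refine ⟨N, fun m hm n hn => ?_⟩
    have := hN m hm n hn
    rw [Lp.edist_toLp_toLp] at this ⊢
    rwa [((hX m).sub (hX n)).eLpNorm_eq hW]
  obtain ⟨I, hI⟩ := cauchySeq_tendsto_of_complete h2
  refine ⟨I, Lp.memLp I, ?_⟩
  rw [← Lp.tendsto_Lp_iff_tendsto_eLpNorm'' X hXm I (Lp.memLp I)]
  simpa using hI

theorem isWienerIntegral_wienerIntegral (hW : IsBrownianMotionOn P T W)
    (hf : ContinuousOn f (Icc 0 T)) {t : ℝ} (ht : t ∈ Icc 0 T) :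
    IsWienerIntegral P W f t (wienerIntegral P W f t) := by
  have h : ∃ I : Ω → ℝ, IsWienerIntegral P W f t I :=
    exists_limit_of_isElementaryIntegral hW
      (fun n => itoSum_eq_itoSumOn W f t n ▸ isElementaryIntegral_itoSumOn W f le_rfl ht.1 ht.2 n)
      (memLp_indicator_of_continuousOn hf le_rfl ht.1 ht.2)
      (tendsto_eLpNorm_leftStep_sub hf le_rfl ht.1 ht.2 (s := fun _ => 0)
        (fun _ => ⟨le_rfl, ht.1⟩) tendsto_const_nhds)
  rw [wienerIntegral, dif_pos h]
  exact h.choose_spec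

/-- The integrals up to `u` and up to `t` are separate `L²` limits. The sum over `[s n, u]` minus
the difference of the sums over `[0, u]` and `[0, t]` is again elementary, and by the isometry its
norm vanishes because the indicator of `(t, u]` is the difference of those of `(0, u]` and `(0, t]`.
-/
theorem tendsto_eLpNorm_itoSumOn_sub (hW : IsBrownianMotionOn P T W)
    (hf : ContinuousOn f (Icc 0 T)) {t u : ℝ} (ht : 0 ≤ t) (htu : t ≤ u) (hu : u ≤ T) {s : ℕ → ℝ}
    (hs : ∀ n, t ≤ s n ∧ s n ≤ u) (hlim : Tendsto s atTop (𝓝 t)) :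
    Tendsto (fun n => eLpNorm (itoSumOn W f (s n) u n -
      (wienerIntegral P W f u - wienerIntegral P W f t)) 2 P) atTop (𝓝 0) := by
  have hIu := isWienerIntegral_wienerIntegral hW hf (t := u) ⟨ht.trans htu, hu⟩
  have hIt := isWienerIntegral_wienerIntegral hW hf (t := t) ⟨ht, htu.trans hu⟩
  set Iu := wienerIntegral P W f u
  set It := wienerIntegral P W f t
  have e1 := fun n => isElementaryIntegral_itoSumOn W f (ht.trans (hs n).1) (hs n).2 hu n
  have e2 := fun n => isElementaryIntegral_itoSumOn W f le_rfl (ht.trans htu) hu n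
  have e3 := fun n => isElementaryIntegral_itoSumOn W f le_rfl ht (htu.trans hu) n
  have l1 := tendsto_eLpNorm_leftStep_sub hf ht htu hu hs hlim
  have l2 := tendsto_eLpNorm_leftStep_sub hf le_rfl (ht.trans htu) hu (s := fun _ => 0)
    (fun _ => ⟨le_rfl, ht.trans htu⟩) tendsto_const_nhds
  have l3 := tendsto_eLpNorm_leftStep_sub hf le_rfl ht (htu.trans hu) (s := fun _ => 0)
    (fun _ => ⟨le_rfl, ht⟩) tendsto_const_nhds
  have m1 := memLp_indicator_of_continuousOn hf ht htu hu
  have m2 := memLp_indicator_of_continuousOn hf le_rfl (ht.trans htu) hu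
  have m3 := memLp_indicator_of_continuousOn hf le_rfl ht (htu.trans hu)
  have hsplit : (Ioc t u).indicator f = (Ioc 0 u).indicator f - (Ioc 0 t).indicator f := by
    ext v
    simp only [indicator, mem_Ioc, Pi.sub_apply]
    grind
  have hsum := ((l1.add l2).add l3).add (hIu.2.add hIt.2)
  simp only [add_zero] at hsum
  refine tendsto_of_tendsto_of_tendsto_of_le_of_le tendsto_const_nhds hsum (fun _ => zero_le)
    fun n => ?_
  have d1 : itoSumOn W f (s n) u n - (Iu - It) =
      (itoSumOn W f (s n) u n - (itoSumOn W f 0 u n - itoSumOn W f 0 t n)) +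
        ((itoSum W f u n - Iu) - (itoSum W f t n - It)) := by
    rw [itoSum_eq_itoSumOn, itoSum_eq_itoSumOn]; abel
  have d2 : leftStep f (s n) u n - (leftStep f 0 u n - leftStep f 0 t n) =
      (leftStep f (s n) u n - (Ioc t u).indicator f) -
        (leftStep f 0 u n - (Ioc 0 u).indicator f) + (leftStep f 0 t n - (Ioc 0 t).indicator f) := by
    rw [hsplit]; abel
  have a1 := ((e1 n).memLp_right.sub m1).1
  have a2 := ((e2 n).memLp_right.sub m2).1
  have a3 := ((e3 n).memLp_right.sub m3).1
  have b1 := (((e1 n).sub ((e2 n).sub (e3 n))).memLp_left hW).1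
  have b2 : AEStronglyMeasurable (itoSum W f u n - Iu) P := by
    rw [itoSum_eq_itoSumOn]; exact (((e2 n).memLp_left hW).sub hIu.1).1
  have b3 : AEStronglyMeasurable (itoSum W f t n - It) P := by
    rw [itoSum_eq_itoSumOn]; exact (((e3 n).memLp_left hW).sub hIt.1).1
  rw [d1]
  refine (eLpNorm_add_le b1 (b2.sub b3) one_le_two).trans
    (add_le_add ?_ (eLpNorm_sub_le b2 b3 one_le_two))
  rw [((e1 n).sub ((e2 n).sub (e3 n))).eLpNorm_eq hW, d2]
  exact (eLpNorm_add_le (a1.sub a2) a3 one_le_two).trans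
    (add_le_add (eLpNorm_sub_le a1 a2 one_le_two) le_rfl)

/-- The uncompleted past `σ(W v : 0 ≤ v ≤ s)`. -/
@[reducible] def rawPast (W : ℝ → Ω → ℝ) (s : ℝ) : MeasurableSpace Ω :=
  ⨆ v ∈ Icc (0 : ℝ) s, MeasurableSpace.comap (W v) inferInstance

omit mΩ in
theorem rawPast_mono {s u : ℝ} (h : s ≤ u) : rawPast W s ≤ rawPast W u :=
  iSup₂_le fun v hv => le_iSup₂_of_le v ⟨hv.1, hv.2.trans h⟩ le_rfl

omit mΩ in
theorem measurable_rawPast {s v : ℝ} (hv : v ∈ Icc 0 s) : Measurable[rawPast W s] (W v) :=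
  Measurable.of_comap_le (le_iSup₂_of_le (f := fun v _ => MeasurableSpace.comap (W v) _) v hv le_rfl)

theorem rawPast_le (hW : IsBrownianMotionOn P T W) {s : ℝ} (hs : s ≤ T) : rawPast W s ≤ mΩ :=
  iSup₂_le fun v hv => (hW.measurable v ⟨hv.1, hv.2.trans hs⟩).comap_le

/-- A partition sum over `[l 0, l n]` is centred Gaussian and independent of the past at `l 0`. -/
theorem setIntegral_exp_sum_increment (hW : IsBrownianMotionOn P T W) [IsProbabilityMeasure P]
    {l : ℕ → ℝ} (hl : Monotone l) (h0 : 0 ≤ l 0) (c : ℕ → ℝ) (y : ℝ) {A : Set Ω}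
    (hA : MeasurableSet[rawPast W (l 0)] A) (n : ℕ) (hn : l n ≤ T) :
    ∫ ω in A, Complex.exp (y * (∑ k ∈ Finset.range n, c k * (W (l (k + 1)) ω - W (l k) ω) : ℝ) *
        Complex.I) ∂P =
      P.real A * Complex.exp (-(∑ k ∈ Finset.range n, c k ^ 2 * (l (k + 1) - l k) : ℝ) *
        y ^ 2 / 2) := by
  have hA' : MeasurableSet A := rawPast_le hW ((hl (Nat.zero_le n)).trans hn) A hA
  induction n with
  | zero => simp
  | succ n ih =>
    have hn' : l n ≤ T := (hl (Nat.le_succ n)).trans hn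
    have h0n : 0 ≤ l n := h0.trans (hl (Nat.zero_le n))
    specialize ih hn'
    rw [← integral_indicator hA'] at ih ⊢
    set X : Ω → ℂ := A.indicator fun ω => Complex.exp (y *
      (∑ k ∈ Finset.range n, c k * (W (l (k + 1)) ω - W (l k) ω) : ℝ) * Complex.I) with hX
    set D : Ω → ℝ := fun ω => W (l (n + 1)) ω - W (l n) ω with hD
    set e : ℝ → ℂ := fun d => Complex.exp ((y * c n : ℝ) * d * Complex.I) with he
    have hXm : Measurable[rawPast W (l n)] X := by
      refine Measurable.indicator ?_ (rawPast_mono (hl (Nat.zero_le n)) A hA)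
      refine Complex.measurable_exp.comp (Measurable.mul_const (Measurable.const_mul
        (Complex.measurable_ofReal.comp (Finset.measurable_sum _ fun k hk => ?_)) _) _)
      have hk := Finset.mem_range.1 hk
      refine Measurable.const_mul (Measurable.sub ?_ ?_) _
      · exact measurable_rawPast ⟨h0.trans (hl (Nat.zero_le _)), hl hk⟩
      · exact measurable_rawPast ⟨h0.trans (hl (Nat.zero_le _)), hl hk.le⟩
    have hem : Measurable e := by fun_prop
    have hgauss := hW.gaussian (l n) (l (n + 1)) h0n (hl (Nat.le_succ n)) hn
    -- `X` collects the set `A` and the earlier increments, all in the past at `l n`, so the last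
    -- increment is independent of it and contributes a Gaussian factor.
    have hind : IndepFun X (e ∘ D) P := by
      rw [IndepFun_iff_Indep]
      refine indep_of_indep_of_le_left (indep_of_indep_of_le_right
        (hW.indep (l n) (l (n + 1)) h0n (hl (Nat.le_succ n)) hn) ?_) hXm.comap_le
      rw [← MeasurableSpace.comap_comp]
      exact MeasurableSpace.comap_mono hem.comap_le
    have hprod : (A.indicator fun ω => Complex.exp (y * (∑ k ∈ Finset.range (n + 1),
        c k * (W (l (k + 1)) ω - W (l k) ω) : ℝ) * Complex.I)) = X * (e ∘ D) := by
      ext ω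
      by_cases h : ω ∈ A
      · simp only [Pi.mul_apply, Function.comp_apply, hX, he, hD, indicator_of_mem h,
          ← Complex.exp_add, Finset.sum_range_succ]
        congr 1
        push_cast
        ring
      · simp [hX, indicator_of_notMem h]
    have hlaw := hgauss.integral_comp (f := e) hem.aestronglyMeasurable
    have hchar : ∫ x, e x ∂(gaussianReal 0 (Real.toNNReal (l (n + 1) - l n))) =
        Complex.exp (-(c n ^ 2 * (l (n + 1) - l n) : ℝ) * y ^ 2 / 2) := by
      rw [he, ← charFun_apply_real, charFun_gaussianReal]
      congr 1
      have : ((Real.toNNReal (l (n + 1) - l n) : ℝ) : ℂ) = ((l (n + 1) - l n : ℝ) : ℂ) := by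
        rw [Real.coe_toNNReal _ (sub_nonneg.2 (hl (Nat.le_succ n)))]
      rw [this]
      push_cast
      ring
    rw [hprod, hind.integral_mul_eq_mul_integral (hXm.mono (rawPast_le hW hn') le_rfl
      ).aestronglyMeasurable (hem.comp_aemeasurable hgauss.aemeasurable).aestronglyMeasurable,
      ih, hlaw, hchar, mul_assoc, ← Complex.exp_add, Finset.sum_range_succ]
    congr 2
    push_cast
    ring

/-- Completion changes sets only by null sets, so independence from the uncompleted past is enough.
-/
theorem exists_rawPast_ae_eq {s : ℝ} {A : Set Ω} (hA : MeasurableSet[completedPast P W s] A) :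
    ∃ B, MeasurableSet[rawPast W s] B ∧ A =ᵐ[P] B := by
  have hle : completedPast P W s ≤ @eventuallyMeasurableSpace Ω (rawPast W s) (ae P) _ := by
    refine sup_le (@le_eventuallyMeasurableSpace Ω (rawPast W s) (ae P) _)
      (MeasurableSpace.generateFrom_le fun N hN => ?_)
    exact ⟨∅, @MeasurableSet.empty Ω (rawPast W s), ae_eq_empty.2 hN⟩
  exact hle A hA

variable [IsProbabilityMeasure P]

/-- The identity holds for the Riemann–Itô sums over `[s n, u]` and passes to the limit along an
almost surely convergent subsequence, the integrands having modulus `1`. The factor `P.real A` on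
the right expresses independence of `A`. -/
theorem setIntegral_exp_wienerIntegral (hW : IsBrownianMotionOn P T W)
    (hf : ContinuousOn f (Icc 0 T)) {t u : ℝ} (ht : 0 ≤ t) (htu : t ≤ u) (hu : u ≤ T) {s : ℕ → ℝ}
    (hs : ∀ n, t ≤ s n ∧ s n ≤ u) (hlim : Tendsto s atTop (𝓝 t)) {A : Set Ω}
    (hA : ∀ n, MeasurableSet[completedPast P W (s n)] A) (y : ℝ) :
    ∫ ω in A, Complex.exp (y * (wienerIntegral P W f u ω - wienerIntegral P W f t ω : ℝ) *
        Complex.I) ∂P =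
      P.real A * Complex.exp (-(∫ v in t..u, f v ^ 2 : ℝ) * y ^ 2 / 2) := by
  set J : Ω → ℝ := wienerIntegral P W f u - wienerIntegral P W f t with hJ
  have hJm : MemLp J 2 P :=
    (isWienerIntegral_wienerIntegral hW hf (t := u) ⟨ht.trans htu, hu⟩).1.sub
      (isWienerIntegral_wienerIntegral hW hf (t := t) ⟨ht, htu.trans hu⟩).1
  have e1 := fun n => isElementaryIntegral_itoSumOn W f (ht.trans (hs n).1) (hs n).2 hu n
  have hDm := fun n => (e1 n).memLp_left hW
  have happ : ∀ n, ∫ ω in A, Complex.exp (y * (itoSumOn W f (s n) u n ω : ℝ) * Complex.I) ∂P =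
      P.real A * Complex.exp (-(∫ v, leftStep f (s n) u n v ^ 2 : ℝ) * y ^ 2 / 2) := by
    intro n
    obtain ⟨B, hB, hAB⟩ := exists_rawPast_ae_eq (hA n)
    rw [setIntegral_congr_set hAB, measureReal_congr hAB]
    unfold leftStep itoSumOn
    rw [integral_sum_indicator_Ioc_sq (uniformPoint_mono (hs n).2 n)]
    refine setIntegral_exp_sum_increment hW (uniformPoint_mono (hs n).2 n) ?_ _ y ?_ n ?_
    · rw [uniformPoint_zero]; exact ht.trans (hs n).1
    · rwa [uniformPoint_zero]
    · exact (uniformPoint_mem (hs n).2 le_rfl).2.trans hu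
  have hR : Tendsto (fun n => (P.real A : ℂ) * Complex.exp (-(∫ v, leftStep f (s n) u n v ^ 2 : ℝ)
      * y ^ 2 / 2)) atTop (𝓝 (P.real A * Complex.exp (-(∫ v in t..u, f v ^ 2 : ℝ) * y ^ 2 / 2))) := by
    have h := tendsto_integral_leftStep_sq hf ht htu hu hs hlim
    have h' := (Complex.continuous_ofReal.tendsto _).comp h
    have hc : Continuous fun z : ℂ => (P.real A : ℂ) * Complex.exp (-z * y ^ 2 / 2) := by fun_prop
    exact (hc.tendsto _).comp h'
  obtain ⟨ns, hns, hae⟩ := (tendstoInMeasure_of_tendsto_eLpNorm two_ne_zero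
    (fun n => (hDm n).1) hJm.1
    (tendsto_eLpNorm_itoSumOn_sub hW hf ht htu hu hs hlim)).exists_seq_tendsto_ae
  have hc : Continuous fun x : ℝ => Complex.exp (y * x * Complex.I) := by fun_prop
  have hL : Tendsto (fun n => ∫ ω in A, Complex.exp (y * (itoSumOn W f (s (ns n)) u (ns n) ω : ℝ) *
      Complex.I) ∂P) atTop (𝓝 (∫ ω in A, Complex.exp (y * (J ω : ℝ) * Complex.I) ∂P)) := by
    refine tendsto_integral_of_dominated_convergence (fun _ => 1) (fun n => ?_)
      (integrable_const _) (fun n => ?_) ?_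
    · exact (hc.comp_aestronglyMeasurable (hDm (ns n)).1).restrict
    · refine ae_of_all _ fun ω => ?_
      rw [← Complex.ofReal_mul, Complex.norm_exp_ofReal_mul_I]
    · filter_upwards [ae_restrict_of_ae hae] with ω h
      exact (hc.tendsto _).comp h
  simp only [happ] at hL
  exact tendsto_nhds_unique hL (hR.comp hns.tendsto_atTop)

/-- On sets of the past at time `t`, the increment of the Wiener integral over `[t, u]` has the
Gaussian law with variance `∫_t^u f²`. -/
theorem map_restrict_wienerIntegral (hW : IsBrownianMotionOn P T W)
    (hf : ContinuousOn f (Icc 0 T)) {t u : ℝ} (ht : 0 ≤ t) (htu : t ≤ u) (hu : u ≤ T) {s : ℕ → ℝ}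
    (hs : ∀ n, t ≤ s n ∧ s n ≤ u) (hlim : Tendsto s atTop (𝓝 t)) {A : Set Ω}
    (hA : ∀ n, MeasurableSet[completedPast P W (s n)] A) :
    (P.restrict A).map (fun ω => wienerIntegral P W f u ω - wienerIntegral P W f t ω) =
      P A • gaussianReal 0 (Real.toNNReal (∫ v in t..u, f v ^ 2)) := by
  have hJm : AEMeasurable (fun ω => wienerIntegral P W f u ω - wienerIntegral P W f t ω) P :=
    ((isWienerIntegral_wienerIntegral hW hf (t := u) ⟨ht.trans htu, hu⟩).1.sub
      (isWienerIntegral_wienerIntegral hW hf (t := t) ⟨ht, htu.trans hu⟩).1).1.aemeasurable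
  have : IsFiniteMeasure (P A • gaussianReal 0 (Real.toNNReal (∫ v in t..u, f v ^ 2))) :=
    Measure.smul_finite _ (measure_ne_top P A)
  refine Measure.ext_of_charFun (funext fun y => ?_)
  have hv : 0 ≤ ∫ v in t..u, f v ^ 2 :=
    intervalIntegral.integral_nonneg htu fun _ _ => sq_nonneg _
  rw [charFun_apply_real, integral_map hJm.restrict (by fun_prop),
    setIntegral_exp_wienerIntegral hW hf ht htu hu hs hlim hA, charFun_apply_real,
    integral_smul_measure, ← charFun_apply_real, charFun_gaussianReal, Real.coe_toNNReal _ hv,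
    Complex.real_smul, Measure.real]
  congr 2
  push_cast
  ring

end WienerIntegral

/-! ### Moments of the density process and the change of measure -/

theorem lintegral_exp_mul_gaussianReal (v : NNReal) (q : ℝ) :
    ∫⁻ x, ENNReal.ofReal (Real.exp (q * x)) ∂(gaussianReal 0 v) =
      ENNReal.ofReal (Real.exp (v * q ^ 2 / 2)) := by
  rw [← ofReal_integral_eq_lintegral_ofReal (integrable_exp_mul_gaussianReal q)
    (ae_of_all _ fun x => (Real.exp_pos _).le)]
  congr 1
  have := mgf_gaussianReal (p := gaussianReal 0 v) (X := id) (μ := 0) (v := v) (by simp) q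
  simpa [mgf] using this

section DensityProcess

variable {Ω : Type*} [mΩ : MeasurableSpace Ω] {P : Measure Ω} {T : ℝ} {W : ℝ → Ω → ℝ}
  {ϑ : ℝ → ℝ}

theorem densityProcess_pos (t : ℝ) (ω : Ω) : 0 < densityProcess P W ϑ t ω := Real.exp_pos _

theorem aestronglyMeasurable_densityProcess (hW : IsBrownianMotionOn P T W)
    (hϑ : ContinuousOn ϑ (Icc 0 T)) {t : ℝ} (ht : t ∈ Icc 0 T) :
    AEStronglyMeasurable (densityProcess P W ϑ t) P := by
  have h := (isWienerIntegral_wienerIntegral hW hϑ ht).1.1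
  exact Real.continuous_exp.comp_aestronglyMeasurable (h.neg.sub aestronglyMeasurable_const)

theorem wienerIntegral_zero_ae (hW : IsBrownianMotionOn P T W) (hT : 0 ≤ T)
    (hϑ : ContinuousOn ϑ (Icc 0 T)) : wienerIntegral P W ϑ 0 =ᵐ[P] 0 := by
  have h := isWienerIntegral_wienerIntegral hW hϑ (t := 0) ⟨le_rfl, hT⟩
  have h0 : ∀ n, itoSum W ϑ 0 n = 0 := by
    intro n; ext ω; simp [itoSum]
  have h2 := h.2
  simp only [h0, zero_sub, eLpNorm_neg] at h2
  exact (eLpNorm_eq_zero_iff h.1.1 two_ne_zero).1 (tendsto_nhds_unique tendsto_const_nhds h2)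

/-- A chosen `L²` limit is only ambient measurable. The `limsup` of an almost surely convergent
subsequence of sums is a version adapted to the uncompleted past. -/
theorem aestronglyMeasurable_densityProcess_past (hW : IsBrownianMotionOn P T W)
    (hϑ : ContinuousOn ϑ (Icc 0 T)) {t : ℝ} (ht : t ∈ Icc 0 T) :
    AEStronglyMeasurable[rawPast W t] (densityProcess P W ϑ t) P := by
  have h := isWienerIntegral_wienerIntegral hW hϑ ht
  have hm : ∀ n, Measurable[rawPast W t] (itoSum W ϑ t n) := by
    intro n
    rw [itoSum_eq_itoSumOn]
    refine Finset.measurable_sum _ fun k hk => Measurable.const_mul (Measurable.sub ?_ ?_) _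
    · exact measurable_rawPast (uniformPoint_mem ht.1 (Finset.mem_range.1 hk))
    · exact measurable_rawPast (uniformPoint_mem ht.1 (Finset.mem_range.1 hk).le)
  obtain ⟨ns, -, hae⟩ := (tendstoInMeasure_of_tendsto_eLpNorm two_ne_zero
    (fun n => ((hm n).mono (rawPast_le hW ht.2) le_rfl).aestronglyMeasurable) h.1.1
    h.2).exists_seq_tendsto_ae
  have hI : AEStronglyMeasurable[rawPast W t] (wienerIntegral P W ϑ t) P :=
    ⟨fun ω => limsup (fun n => itoSum W ϑ t (ns n) ω) atTop,
      (Measurable.limsup fun n => hm (ns n)).stronglyMeasurable,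
      hae.mono fun ω h => h.limsup_eq.symm⟩
  exact Real.continuous_exp.comp_aestronglyMeasurable (hI.neg.sub aestronglyMeasurable_const)

omit mΩ in
theorem rawPast_le_brownianFiltration [MeasurableSpace Ω] {P : Measure Ω} {t : ℝ} (ht : t ≤ T) :
    rawPast W t ≤ brownianFiltration P T W t :=
  le_iInf₂ fun _ hs => (rawPast_mono (le_min (le_of_lt hs) ht)).trans le_sup_left

theorem measurableSet_completedPast_of_brownianFiltration {t s : ℝ} {A : Set Ω}
    (hA : MeasurableSet[brownianFiltration P T W t] A) (hts : t < s) (hs : s ≤ T) :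
    MeasurableSet[completedPast P W s] A := by
  have h : brownianFiltration P T W t ≤ completedPast P W (min s T) := iInf₂_le s hts
  rw [min_eq_left hs] at h
  exact h A hA

theorem densityProcess_div (hϑ : ContinuousOn ϑ (Icc 0 T)) {t u : ℝ} (ht : 0 ≤ t) (htu : t ≤ u)
    (hu : u ≤ T) (ω : Ω) :
    densityProcess P W ϑ u ω / densityProcess P W ϑ t ω =
      Real.exp (-(wienerIntegral P W ϑ u ω - wienerIntegral P W ϑ t ω)
        - 1 / 2 * ∫ v in t..u, |ϑ v| ^ 2) := by
  have hint : ∀ {a b : ℝ}, a ∈ Icc 0 T → b ∈ Icc 0 T →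
      IntervalIntegrable (fun v => |ϑ v| ^ 2) volume a b := fun ha hb =>
    ContinuousOn.intervalIntegrable ((hϑ.mono (uIcc_subset_Icc ha hb)).abs.pow 2)
  have h0 : (0 : ℝ) ∈ Icc 0 T := ⟨le_rfl, ht.trans (htu.trans hu)⟩
  rw [densityProcess, densityProcess, ← Real.exp_sub,
    ← intervalIntegral.integral_add_adjacent_intervals
      (hint h0 ⟨ht, htu.trans hu⟩) (hint ⟨ht, htu.trans hu⟩ ⟨ht.trans htu, hu⟩)]
  congr 1
  ring

variable [IsProbabilityMeasure P]

/-- With `V = ∫_t^u |ϑ|²`, the Gaussian exponential moment contributes `p² V / 2` and the drift `-p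
V / 2`. The case `p = 1` is the martingale property; `p = 2` gives `exp V`. -/
theorem setLIntegral_densityProcess_div_pow (hW : IsBrownianMotionOn P T W)
    (hϑ : ContinuousOn ϑ (Icc 0 T)) {t u : ℝ} (ht : 0 ≤ t) (htu : t ≤ u) (hu : u ≤ T) {s : ℕ → ℝ}
    (hs : ∀ n, t ≤ s n ∧ s n ≤ u) (hlim : Tendsto s atTop (𝓝 t)) {A : Set Ω}
    (hA : ∀ n, MeasurableSet[completedPast P W (s n)] A) (p : ℕ) :
    ∫⁻ ω in A, ENNReal.ofReal (densityProcess P W ϑ u ω / densityProcess P W ϑ t ω) ^ p ∂P =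
      P A * ENNReal.ofReal (Real.exp (((p : ℝ) ^ 2 - p) / 2 * ∫ v in t..u, |ϑ v| ^ 2)) := by
  have hJm : AEMeasurable (fun ω => wienerIntegral P W ϑ u ω - wienerIntegral P W ϑ t ω) P :=
    ((isWienerIntegral_wienerIntegral hW hϑ (t := u) ⟨ht.trans htu, hu⟩).1.sub
      (isWienerIntegral_wienerIntegral hW hϑ (t := t) ⟨ht, htu.trans hu⟩).1).1.aemeasurable
  have hv : 0 ≤ ∫ v in t..u, ϑ v ^ 2 :=
    intervalIntegral.integral_nonneg htu fun _ _ => sq_nonneg _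
  simp only [densityProcess_div hϑ ht htu hu, sq_abs]
  set V := ∫ v in t..u, ϑ v ^ 2 with hV
  have h1 : ∀ ω, ENNReal.ofReal (Real.exp (-(wienerIntegral P W ϑ u ω - wienerIntegral P W ϑ t ω)
        - 1 / 2 * V)) ^ p = ENNReal.ofReal (Real.exp (-(p / 2 * V))) * ENNReal.ofReal (Real.exp
          (-p * (wienerIntegral P W ϑ u ω - wienerIntegral P W ϑ t ω))) := by
    intro ω
    rw [← ENNReal.ofReal_pow (Real.exp_pos _).le, ← Real.exp_nat_mul,
      ← ENNReal.ofReal_mul (Real.exp_pos _).le, ← Real.exp_add]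
    congr 2
    ring
  simp only [h1]
  rw [lintegral_const_mul' _ _ ENNReal.ofReal_ne_top,
    ← lintegral_map' (f := fun x : ℝ => ENNReal.ofReal (Real.exp (-p * x))) (by fun_prop)
      hJm.restrict, map_restrict_wienerIntegral hW hϑ ht htu hu hs hlim hA, lintegral_smul_measure,
    lintegral_exp_mul_gaussianReal, ← hV, Real.coe_toNNReal _ hv, smul_eq_mul, mul_left_comm,
    ← ENNReal.ofReal_mul (Real.exp_pos _).le, ← Real.exp_add]
  congr 3
  ring

/-- The conditional moments of the density increment given the past. -/
theorem setLIntegral_densityProcess_div_pow_of_brownianFiltration (hW : IsBrownianMotionOn P T W)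
    (hϑ : ContinuousOn ϑ (Icc 0 T)) {t : ℝ} (ht : t ∈ Ico 0 T) {A : Set Ω}
    (hA : MeasurableSet[brownianFiltration P T W t] A) (p : ℕ) :
    ∫⁻ ω in A, ENNReal.ofReal (densityProcess P W ϑ T ω / densityProcess P W ϑ t ω) ^ p ∂P =
      P A * ENNReal.ofReal (Real.exp (((p : ℝ) ^ 2 - p) / 2 * ∫ v in t..T, |ϑ v| ^ 2)) := by
  have hd : 0 < T - t := sub_pos.2 ht.2
  have hs : ∀ n : ℕ, t < t + (T - t) / ((n : ℝ) + 1) ∧ t + (T - t) / ((n : ℝ) + 1) ≤ T := by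
    intro n
    have hn : (1 : ℝ) ≤ (n : ℝ) + 1 := by simp
    have h1 : (T - t) / ((n : ℝ) + 1) ≤ T - t := div_le_self hd.le hn
    exact ⟨lt_add_of_pos_right _ (by positivity), by linarith⟩
  -- The times `t + (T - t) / (n + 1)` decrease to `t` and stay strictly above it, so each completed
  -- past contains `𝓕 t`.
  refine setLIntegral_densityProcess_div_pow hW hϑ ht.1 ht.2.le le_rfl
    (s := fun n => t + (T - t) / ((n : ℝ) + 1)) (fun n => ⟨(hs n).1.le, (hs n).2⟩) ?_
    (fun n => measurableSet_completedPast_of_brownianFiltration hA (hs n).1 (hs n).2) p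
  have h := (tendsto_const_div_atTop_nhds_zero_nat (T - t)).comp (tendsto_add_atTop_nat 1)
  simpa using h.const_add t

theorem lintegral_densityProcess_pow (hW : IsBrownianMotionOn P T W)
    (hϑ : ContinuousOn ϑ (Icc 0 T)) {t : ℝ} (ht : t ∈ Icc 0 T) (p : ℕ) :
    ∫⁻ ω, ENNReal.ofReal (densityProcess P W ϑ t ω) ^ p ∂P =
      ENNReal.ofReal (Real.exp (((p : ℝ) ^ 2 - p) / 2 * ∫ v in (0 : ℝ)..t, |ϑ v| ^ 2)) := by
  have h := setLIntegral_densityProcess_div_pow hW hϑ le_rfl ht.1 ht.2 (s := fun _ => 0)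
    (fun _ => ⟨le_rfl, ht.1⟩) tendsto_const_nhds (A := univ) (fun _ => MeasurableSet.univ) p
  rw [Measure.restrict_univ, measure_univ, one_mul] at h
  rw [← h]
  refine lintegral_congr_ae ?_
  filter_upwards [wienerIntegral_zero_ae hW (ht.1.trans ht.2) hϑ] with ω hω
  have : densityProcess P W ϑ 0 ω = 1 := by simp [densityProcess, hω]
  simp [this]

theorem memLp_densityProcess (hW : IsBrownianMotionOn P T W)
    (hϑ : ContinuousOn ϑ (Icc 0 T)) {t : ℝ} (ht : t ∈ Icc 0 T) :
    MemLp (densityProcess P W ϑ t) 2 P := by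
  have hm := aestronglyMeasurable_densityProcess hW hϑ ht
  rw [memLp_two_iff_integrable_sq hm]
  refine ⟨hm.pow 2, ?_⟩
  rw [hasFiniteIntegral_iff_ofReal (ae_of_all _ fun ω => sq_nonneg _)]
  simp only [ENNReal.ofReal_pow (densityProcess_pos _ _).le]
  rw [lintegral_densityProcess_pow hW hϑ ht]
  exact ENNReal.ofReal_lt_top

theorem isProbabilityMeasure_riskNeutralMeasure (hW : IsBrownianMotionOn P T W) (hT : 0 ≤ T)
    (hϑ : ContinuousOn ϑ (Icc 0 T)) : IsProbabilityMeasure (riskNeutralMeasure P T W ϑ) := by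
  constructor
  have h := lintegral_densityProcess_pow hW hϑ (t := T) ⟨hT, le_rfl⟩ 1
  rw [riskNeutralMeasure, withDensity_apply _ MeasurableSet.univ, Measure.restrict_univ]
  simpa using h

omit [IsProbabilityMeasure P] in
theorem ae_riskNeutralMeasure_iff (hW : IsBrownianMotionOn P T W) (hT : 0 ≤ T)
    (hϑ : ContinuousOn ϑ (Icc 0 T)) {p : Ω → Prop} :
    (∀ᵐ ω ∂(riskNeutralMeasure P T W ϑ), p ω) ↔ ∀ᵐ ω ∂P, p ω := by
  have hm := (aestronglyMeasurable_densityProcess hW hϑ (t := T)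
    ⟨hT, le_rfl⟩).aemeasurable.ennreal_ofReal
  rw [riskNeutralMeasure, ae_withDensity_iff' hm]
  refine eventually_congr (ae_of_all _ fun ω => ?_)
  simp [densityProcess_pos]

end DensityProcess

/-! ### The deterministic system for a single law -/

/-- The positive part `(η - y + w z)₊` as a function of `v = (z, y)`. -/
def affinePayoff (η w : ℝ) (v : ℝ × ℝ) : ℝ := max (η - v.2 + w * v.1) 0

/-- A law of a pair `(z, y)`, square integrable, with `z ≥ 0` of mean `1` and second moment at most
`m`, and with `y ≥ c`. -/
structure IsAdmissibleLaw (m c : ℝ) (μ : Measure (ℝ × ℝ)) : Prop where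
  fst_nonneg : ∀ᵐ v ∂μ, 0 ≤ v.1
  memLp_fst : MemLp Prod.fst 2 μ
  memLp_snd : MemLp Prod.snd 2 μ
  integral_fst : ∫ v, v.1 ∂μ = 1
  integral_fst_sq_le : ∫ v, v.1 ^ 2 ∂μ ≤ m
  le_snd : ∀ᵐ v ∂μ, c ≤ v.2

theorem affinePayoff_nonneg (η w : ℝ) (v : ℝ × ℝ) : 0 ≤ affinePayoff η w v := le_max_right _ _

theorem measurable_affinePayoff (η w : ℝ) : Measurable (affinePayoff η w) := by
  unfold affinePayoff; fun_prop

namespace IsAdmissibleLaw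

variable {m c : ℝ} {μ : Measure (ℝ × ℝ)} [IsProbabilityMeasure μ]

theorem memLp_affinePayoff (h : IsAdmissibleLaw m c μ) (η w : ℝ) :
    MemLp (affinePayoff η w) 2 μ :=
  (((memLp_const η).sub h.memLp_snd).add (h.memLp_fst.const_mul w)).pos_part

theorem integrable_affinePayoff (h : IsAdmissibleLaw m c μ) (η w : ℝ) :
    Integrable (affinePayoff η w) μ := (h.memLp_affinePayoff η w).integrable one_le_two

theorem integrable_fst (h : IsAdmissibleLaw m c μ) : Integrable (fun v : ℝ × ℝ => v.1) μ :=
  h.memLp_fst.integrable one_le_two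

theorem integrable_snd (h : IsAdmissibleLaw m c μ) : Integrable (fun v : ℝ × ℝ => v.2) μ :=
  h.memLp_snd.integrable one_le_two

theorem integrable_fst_mul_affinePayoff (h : IsAdmissibleLaw m c μ) (η w : ℝ) :
    Integrable (fun v => v.1 * affinePayoff η w v) μ :=
  h.memLp_fst.integrable_mul (h.memLp_affinePayoff η w)

theorem integral_affinePayoff_mono (h : IsAdmissibleLaw m c μ) {η₁ η₂ : ℝ} (hη : η₁ ≤ η₂)
    (w : ℝ) : ∫ v, affinePayoff η₁ w v ∂μ ≤ ∫ v, affinePayoff η₂ w v ∂μ :=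
  integral_mono (h.integrable_affinePayoff _ _) (h.integrable_affinePayoff _ _) fun v => by
    simp only [affinePayoff]; gcongr

/-- If the means agree, the payoffs agree almost everywhere, which for distinct `η` is possible only
where both vanish; a positive mean excludes this. -/
theorem integral_affinePayoff_lt (h : IsAdmissibleLaw m c μ) {η₁ η₂ w : ℝ} (hη : η₁ < η₂)
    (hpos : 0 < ∫ v, affinePayoff η₁ w v ∂μ) :
    ∫ v, affinePayoff η₁ w v ∂μ < ∫ v, affinePayoff η₂ w v ∂μ := by
  refine lt_of_le_of_ne (h.integral_affinePayoff_mono hη.le w) fun heq => hpos.ne' ?_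
  have hle : affinePayoff η₁ w ≤ affinePayoff η₂ w := fun v => by
    simp only [affinePayoff]; gcongr
  have hae := (integral_eq_iff_of_ae_le (h.integrable_affinePayoff _ _)
    (h.integrable_affinePayoff _ _) (ae_of_all _ hle)).1 heq
  refine integral_eq_zero_of_ae ?_
  filter_upwards [hae] with v hv
  simp only [affinePayoff, Pi.zero_apply] at hv ⊢
  grind

theorem continuous_integral_affinePayoff (h : IsAdmissibleLaw m c μ) (w : ℝ) :
    Continuous fun η => ∫ v, affinePayoff η w v ∂μ := by
  have hL : LipschitzWith 1 fun η => ∫ v, affinePayoff η w v ∂μ := by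
    refine LipschitzWith.of_dist_le_mul fun η₁ η₂ => ?_
    rw [Real.dist_eq, Real.dist_eq, ← integral_sub (h.integrable_affinePayoff _ _)
      (h.integrable_affinePayoff _ _), ← Real.norm_eq_abs]
    refine (norm_integral_le_of_norm_le_const (C := |η₁ - η₂|) (ae_of_all _ fun v => ?_)).trans
      (by simp)
    have := abs_max_sub_max_le_abs (η₁ - v.2 + w * v.1) (η₂ - v.2 + w * v.1) 0
    rwa [add_sub_add_right_eq_sub, sub_sub_sub_cancel_right] at this
  exact hL.continuous

theorem exists_integral_affinePayoff_eq (h : IsAdmissibleLaw m c μ) (w : ℝ) {k : ℝ} (hk : 0 < k) :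
    ∃ η, ∫ v, affinePayoff η w v ∂μ = k := by
  refine mem_range_of_exists_le_of_exists_ge (h.continuous_integral_affinePayoff w) ?_ ?_
  · have hlim : Tendsto (fun n : ℕ => ∫ v, affinePayoff (-(n : ℝ)) w v ∂μ) atTop (𝓝 0) := by
      rw [← integral_zero (ℝ × ℝ) ℝ (μ := μ)]
      refine tendsto_integral_of_dominated_convergence (affinePayoff 0 w)
        (fun n => (measurable_affinePayoff _ _).aestronglyMeasurable)
        (h.integrable_affinePayoff 0 w) (fun n => ae_of_all _ fun v => ?_) (ae_of_all _ fun v => ?_)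
      · rw [Real.norm_of_nonneg (affinePayoff_nonneg _ _ _)]
        simp only [affinePayoff]
        gcongr
        simp
      · refine tendsto_const_nhds.congr' ?_
        filter_upwards [eventually_ge_atTop ⌈-v.2 + w * v.1⌉₊] with n hn
        have := Nat.ceil_le.1 hn
        exact (max_eq_right (by linarith)).symm
    obtain ⟨n, hn⟩ := (hlim.eventually_lt_const hk).exists
    exact ⟨_, hn.le⟩
  -- Since `z` has mean `1`, this `η` gives the affine function mean exactly `k`; taking the
  -- positive part can only increase it.
  · refine ⟨k + ∫ v, v.2 ∂μ - w, ?_⟩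
    have hint₀ : Integrable (fun v : ℝ × ℝ => k + ∫ v, v.2 ∂μ - w - v.2) μ :=
      (integrable_const _).sub h.integrable_snd
    have hint : Integrable (fun v : ℝ × ℝ => k + ∫ v, v.2 ∂μ - w - v.2 + w * v.1) μ :=
      hint₀.add (h.integrable_fst.const_mul w)
    calc k = ∫ v, (k + ∫ v, v.2 ∂μ - w - v.2 + w * v.1) ∂μ := by
          rw [integral_add hint₀ (h.integrable_fst.const_mul w), integral_sub (integrable_const _) h.integrable_snd,
            integral_const_mul, h.integral_fst]
          simp
          ring
      _ ≤ _ := integral_mono hint (h.integrable_affinePayoff _ _) fun v => le_max_left _ _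

/-- Besides uniqueness of `η`, this describes its sublevel sets through integrals at a fixed level
`p`, the form used for measurability. -/
theorem le_iff_le_integral_affinePayoff (h : IsAdmissibleLaw m c μ) {η w k p : ℝ} (hk : 0 < k)
    (hη : ∫ v, affinePayoff η w v ∂μ = k) : η ≤ p ↔ k ≤ ∫ v, affinePayoff p w v ∂μ := by
  refine ⟨fun hp => hη ▸ h.integral_affinePayoff_mono hp w, fun hp => ?_⟩
  by_contra! hlt
  rcases lt_or_ge 0 (∫ v, affinePayoff p w v ∂μ) with h0 | h0
  · exact absurd (h.integral_affinePayoff_lt hlt h0) (by rw [hη]; exact not_lt.2 hp)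
  · linarith

theorem eq_of_integral_affinePayoff_eq (h : IsAdmissibleLaw m c μ) {η₁ η₂ w k : ℝ} (hk : 0 < k)
    (h₁ : ∫ v, affinePayoff η₁ w v ∂μ = k) (h₂ : ∫ v, affinePayoff η₂ w v ∂μ = k) : η₁ = η₂ :=
  le_antisymm ((h.le_iff_le_integral_affinePayoff hk h₁).2 h₂.ge)
    ((h.le_iff_le_integral_affinePayoff hk h₂).2 h₁.ge)

/-- Along pairs `(η, w)` with constant mean payoff, the mean payoff weighted by `z` is
nondecreasing and `m`-Lipschitz in `w`. -/
theorem integral_fst_mul_affinePayoff_sub (h : IsAdmissibleLaw m c μ) {η₁ η₂ w₁ w₂ k : ℝ}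
    (hk : 0 < k) (h₁ : ∫ v, affinePayoff η₁ w₁ v ∂μ = k)
    (h₂ : ∫ v, affinePayoff η₂ w₂ v ∂μ = k) (hw : w₁ ≤ w₂) :
    (∫ v, v.1 * affinePayoff η₂ w₂ v ∂μ) - ∫ v, v.1 * affinePayoff η₁ w₁ v ∂μ ∈
      Icc 0 (m * (w₂ - w₁)) := by
  rcases hw.eq_or_lt with rfl | hlt
  · rw [h.eq_of_integral_affinePayoff_eq hk h₁ h₂]
    simp
  set d : ℝ × ℝ → ℝ := fun v => affinePayoff η₂ w₂ v - affinePayoff η₁ w₁ v with hd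
  have hdm : MemLp d 2 μ := (h.memLp_affinePayoff _ _).sub (h.memLp_affinePayoff _ _)
  have hdi : Integrable d μ := hdm.integrable one_le_two
  have hZd : Integrable (fun v => v.1 * d v) μ := h.memLp_fst.integrable_mul hdm
  have hd2 : Integrable (fun v => d v ^ 2) μ := hdm.integrable_sq
  have hZ2 : Integrable (fun v : ℝ × ℝ => v.1 ^ 2) μ := h.memLp_fst.integrable_sq
  have hd0 : ∫ v, d v ∂μ = 0 := by
    rw [integral_sub (h.integrable_affinePayoff _ _) (h.integrable_affinePayoff _ _), h₁, h₂,
      sub_self]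
  have hq : (∫ v, v.1 * affinePayoff η₂ w₂ v ∂μ) - ∫ v, v.1 * affinePayoff η₁ w₁ v ∂μ =
      ∫ v, v.1 * d v ∂μ := by
    rw [← integral_sub (h.integrable_fst_mul_affinePayoff _ _)
      (h.integrable_fst_mul_affinePayoff _ _)]
    simp only [hd, mul_sub]
  rw [hq]
  set q := ∫ v, v.1 * d v ∂μ
  have hδ : 0 < w₂ - w₁ := sub_pos.2 hlt
  -- The inequality `(x₊ - y₊)² ≤ (x - y)(x₊ - y₊)` is applied with `x - y = (η₂ - η₁) + (w₂ - w₁)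
  -- z`; the constant part drops out because `d` has mean zero. In particular `q ≥ 0`.
  have h3 : ∫ v, d v ^ 2 ∂μ ≤ (w₂ - w₁) * q := by
    calc ∫ v, d v ^ 2 ∂μ ≤ ∫ v, ((η₂ - η₁) * d v + (w₂ - w₁) * (v.1 * d v)) ∂μ := by
          refine integral_mono hd2 ((hdi.const_mul _).add (hZd.const_mul _)) fun v => ?_
          simp only [hd, affinePayoff]
          have : ∀ x y : ℝ, (max x 0 - max y 0) ^ 2 ≤ (x - y) * (max x 0 - max y 0) := by
            intro x y
            rcases le_total x 0 with hx | hx <;> rcases le_total y 0 with hy | hy <;>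
              simp only [max_eq_left, max_eq_right, hx, hy] <;> nlinarith
          refine (this _ _).trans (le_of_eq ?_)
          ring
      _ = (w₂ - w₁) * q := by
          rw [integral_add (hdi.const_mul _) (hZd.const_mul _), integral_const_mul,
            integral_const_mul, hd0, mul_zero, zero_add]
  have h4 : 0 ≤ ∫ v, d v ^ 2 ∂μ := integral_nonneg fun v => sq_nonneg _
  -- This is `∫ (d - (w₂ - w₁) z)² ≥ 0` expanded. Together with `h3` it yields `(w₂ - w₁) q ≤ (w₂ -
  -- w₁)² ∫ z²`, the Lipschitz bound with the sharp constant needed for `a < ρ` to suffice.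
  have h5 : 0 ≤ (∫ v, d v ^ 2 ∂μ) - 2 * (w₂ - w₁) * q + (w₂ - w₁) ^ 2 * ∫ v, v.1 ^ 2 ∂μ := by
    have hint : Integrable (fun v => d v ^ 2 - 2 * (w₂ - w₁) * (v.1 * d v)) μ :=
      hd2.sub (hZd.const_mul _)
    rw [← integral_const_mul, ← integral_const_mul, ← integral_sub hd2 (hZd.const_mul _),
      ← integral_add hint (hZ2.const_mul _)]
    refine integral_nonneg fun v => ?_
    simp only [Pi.zero_apply]
    nlinarith [sq_nonneg (d v - (w₂ - w₁) * v.1)]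
  have h6 := h.integral_fst_sq_le
  constructor
  · nlinarith
  · have : (w₂ - w₁) ^ 2 * ∫ v, v.1 ^ 2 ∂μ ≤ (w₂ - w₁) ^ 2 * m := by gcongr
    have h7 : 0 ≤ (w₂ - w₁) * (m * (w₂ - w₁) - q) := by nlinarith
    have := nonneg_of_mul_nonneg_right h7 hδ
    linarith

theorem abs_integral_fst_mul_affinePayoff_sub_le (h : IsAdmissibleLaw m c μ) {η₁ η₂ w₁ w₂ k : ℝ}
    (hk : 0 < k) (h₁ : ∫ v, affinePayoff η₁ w₁ v ∂μ = k)
    (h₂ : ∫ v, affinePayoff η₂ w₂ v ∂μ = k) :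
    |(∫ v, v.1 * affinePayoff η₂ w₂ v ∂μ) - ∫ v, v.1 * affinePayoff η₁ w₁ v ∂μ| ≤
      m * |w₂ - w₁| := by
  rcases le_total w₁ w₂ with hw | hw
  · have := h.integral_fst_mul_affinePayoff_sub hk h₁ h₂ hw
    rw [abs_of_nonneg this.1, abs_of_nonneg (sub_nonneg.2 hw)]
    exact this.2
  · have := h.integral_fst_mul_affinePayoff_sub hk h₂ h₁ hw
    rw [abs_sub_comm, abs_sub_comm w₂, abs_of_nonneg this.1, abs_of_nonneg (sub_nonneg.2 hw)]
    exact this.2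

variable {a ρ k : ℝ}

theorem strict_monotonicity (h : IsAdmissibleLaw m c μ) (ha : 0 < a) (hk : 0 < k)
    {η₁ η₂ w₁ w₂ : ℝ} (h₁ : ∫ v, affinePayoff η₁ w₁ v ∂μ = k)
    (h₂ : ∫ v, affinePayoff η₂ w₂ v ∂μ = k) (hw : w₁ ≤ w₂) :
    (ρ - a) * m * (w₂ - w₁) ≤ (ρ * m * w₂ - a * ∫ v, v.1 * affinePayoff η₂ w₂ v ∂μ) -
      (ρ * m * w₁ - a * ∫ v, v.1 * affinePayoff η₁ w₁ v ∂μ) := by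
  have := (h.integral_fst_mul_affinePayoff_sub hk h₁ h₂ hw).2
  nlinarith

theorem exists_solution (h : IsAdmissibleLaw m c μ) (ha : 0 < a) (haρ : a < ρ) (hm : 0 < m)
    (hk : 0 < k) (b : ℝ) : ∃ η w, ∫ v, affinePayoff η w v ∂μ = k ∧
      ρ * m * w - a * ∫ v, v.1 * affinePayoff η w v ∂μ = b := by
  choose e he using fun w => h.exists_integral_affinePayoff_eq w hk
  have hρ : 0 < ρ := ha.trans haρ
  -- Fixed points of `φ` are the solutions of the second equation along the curve `η = e w`; the
  -- factor `m` cancels and leaves the ratio `a / ρ`.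
  set φ : ℝ → ℝ := fun w => (a * (∫ v, v.1 * affinePayoff (e w) w v ∂μ) + b) / (ρ * m) with hφ
  have hc : ContractingWith (Real.toNNReal (a / ρ)) φ := by
    refine ⟨?_, LipschitzWith.of_dist_le_mul fun w₁ w₂ => ?_⟩
    · rw [Real.toNNReal_lt_one]
      exact (div_lt_one hρ).2 haρ
    · have := h.abs_integral_fst_mul_affinePayoff_sub_le hk (he w₂) (he w₁)
      rw [Real.dist_eq, Real.dist_eq, Real.coe_toNNReal _ (by positivity), hφ]
      simp only
      rw [← sub_div, add_sub_add_right_eq_sub, ← mul_sub, abs_div, abs_mul, abs_of_pos ha,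
        abs_of_pos (mul_pos hρ hm), div_le_iff₀ (mul_pos hρ hm)]
      calc _ ≤ a * (m * |w₁ - w₂|) := by gcongr
        _ = _ := by field_simp
  have hfix := hc.fixedPoint_isFixedPt
  set w := ContractingWith.fixedPoint φ hc
  refine ⟨e w, w, he w, ?_⟩
  have h1 : φ w = w := hfix
  rw [hφ] at h1
  simp only at h1
  rw [div_eq_iff (by positivity)] at h1
  linarith

theorem solution_unique (h : IsAdmissibleLaw m c μ) (ha : 0 < a) (haρ : a < ρ) (hm : 0 < m)
    (hk : 0 < k) {b η₁ η₂ w₁ w₂ : ℝ} (h₁ : ∫ v, affinePayoff η₁ w₁ v ∂μ = k)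
    (h₁' : ρ * m * w₁ - a * ∫ v, v.1 * affinePayoff η₁ w₁ v ∂μ = b)
    (h₂ : ∫ v, affinePayoff η₂ w₂ v ∂μ = k)
    (h₂' : ρ * m * w₂ - a * ∫ v, v.1 * affinePayoff η₂ w₂ v ∂μ = b) : η₁ = η₂ ∧ w₁ = w₂ := by
  have hpos : 0 < (ρ - a) * m := mul_pos (sub_pos.2 haρ) hm
  have hw : w₁ = w₂ := by
    rcases le_total w₁ w₂ with hw | hw
    · have := h.strict_monotonicity (ρ := ρ) ha hk h₁ h₂ hw
      rw [h₁', h₂'] at this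
      nlinarith
    · have := h.strict_monotonicity (ρ := ρ) ha hk h₂ h₁ hw
      rw [h₁', h₂'] at this
      nlinarith
  subst hw
  exact ⟨h.eq_of_integral_affinePayoff_eq hk h₁ h₂, rfl⟩

/-- Testing `w₁ ≤ w₂` needs only the second expression at the known value `w₂`, so sublevel sets of
the solution can be described without it. -/
theorem le_iff_of_solution (h : IsAdmissibleLaw m c μ) (ha : 0 < a) (haρ : a < ρ) (hm : 0 < m)
    (hk : 0 < k) {b η₁ η₂ w₁ w₂ : ℝ} (h₁ : ∫ v, affinePayoff η₁ w₁ v ∂μ = k)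
    (h₁' : ρ * m * w₁ - a * ∫ v, v.1 * affinePayoff η₁ w₁ v ∂μ = b)
    (h₂ : ∫ v, affinePayoff η₂ w₂ v ∂μ = k) :
    w₁ ≤ w₂ ↔ b ≤ ρ * m * w₂ - a * ∫ v, v.1 * affinePayoff η₂ w₂ v ∂μ := by
  have hpos : 0 < (ρ - a) * m := mul_pos (sub_pos.2 haρ) hm
  constructor
  · intro hw
    have := h.strict_monotonicity (ρ := ρ) ha hk h₁ h₂ hw
    have := mul_nonneg hpos.le (sub_nonneg.2 hw)
    linarith
  · intro hb
    by_contra! hw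
    have := h.strict_monotonicity (ρ := ρ) ha hk h₂ h₁ hw.le
    have := mul_pos hpos (sub_pos.2 hw)
    linarith

/-- The solution is compared with `w = 0`. There the payoff is `(η₀ - y)₊` with `η₀ ≤ k + ∫ y` and
`y ≥ c`, hence bounded by a constant, and the weight `z` has mean `1`. The lower slope bound then
controls `|w|`. -/
theorem abs_solution_le (h : IsAdmissibleLaw m c μ) (ha : 0 < a) (haρ : a < ρ) (hm : 0 < m)
    (hk : 0 < k) {b η w : ℝ} (h₁ : ∫ v, affinePayoff η w v ∂μ = k)
    (h₁' : ρ * m * w - a * ∫ v, v.1 * affinePayoff η w v ∂μ = b) :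
    (ρ - a) * m * |w| ≤ |b| + a * (k + ∫ v, |v.2| ∂μ + |c|) := by
  obtain ⟨η₀, h₀⟩ := h.exists_integral_affinePayoff_eq 0 hk
  set q₀ := ∫ v, v.1 * affinePayoff η₀ 0 v ∂μ with hq₀
  have hpos : 0 < (ρ - a) * m := mul_pos (sub_pos.2 haρ) hm
  have hη₀ : η₀ - ∫ v, v.2 ∂μ ≤ k := by
    calc η₀ - ∫ v, v.2 ∂μ = ∫ v, (η₀ - v.2) ∂μ := by
          rw [integral_sub (integrable_const _) h.integrable_snd]; simp
      _ ≤ ∫ v, affinePayoff η₀ 0 v ∂μ :=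
          integral_mono ((integrable_const _).sub h.integrable_snd)
            (h.integrable_affinePayoff _ _) fun v => by simp [affinePayoff]
      _ = k := h₀
  have hY : ∫ v, v.2 ∂μ ≤ ∫ v, |v.2| ∂μ :=
    integral_mono h.integrable_snd h.integrable_snd.abs fun v => le_abs_self _
  have hB : 0 ≤ k + ∫ v, |v.2| ∂μ + |c| := by
    have : 0 ≤ ∫ v, |v.2| ∂μ := integral_nonneg fun _ => abs_nonneg _
    positivity
  have hq0 : 0 ≤ q₀ := by
    refine integral_nonneg_of_ae ?_
    filter_upwards [h.fst_nonneg] with v hv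
    exact mul_nonneg hv (affinePayoff_nonneg _ _ _)
  have hq1 : q₀ ≤ k + ∫ v, |v.2| ∂μ + |c| := by
    calc q₀ ≤ ∫ v, v.1 * (k + ∫ v, |v.2| ∂μ + |c|) ∂μ := by
          refine integral_mono_ae (h.integrable_fst_mul_affinePayoff _ _)
            (h.integrable_fst.mul_const _) ?_
          filter_upwards [h.fst_nonneg, h.le_snd] with v hv hc
          refine mul_le_mul_of_nonneg_left (max_le ?_ hB) hv
          have := neg_abs_le c
          linarith
      _ = _ := by rw [integral_mul_const, h.integral_fst, one_mul]
  have haq : a * q₀ ≤ a * (k + ∫ v, |v.2| ∂μ + |c|) := by gcongr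
  have haq0 : 0 ≤ a * q₀ := by positivity
  rcases le_total 0 w with hw | hw
  · have := h.strict_monotonicity (ρ := ρ) ha hk h₀ h₁ hw
    rw [h₁', ← hq₀] at this
    rw [abs_of_nonneg hw]
    have := le_abs_self b
    linarith
  · have := h.strict_monotonicity (ρ := ρ) ha hk h₁ h₀ hw
    rw [h₁', ← hq₀] at this
    rw [abs_of_nonpos hw]
    have := neg_abs_le b
    linarith

end IsAdmissibleLaw

/-! ### Extended-valued forms of the equations -/

theorem EReal.coe_eq_coe_mul_coe_ennreal_iff {a : ℝ} (ha : 0 < a) (x : ℝ) (e : ENNReal) :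
    (x : EReal) = (a : EReal) * (e : EReal) ↔ e ≠ ⊤ ∧ x = a * e.toReal := by
  rcases eq_or_ne e ⊤ with rfl | he
  · simp [EReal.coe_mul_top_of_pos ha]
  · rw [← EReal.coe_ennreal_toReal he, ← EReal.coe_mul, EReal.coe_eq_coe_iff]
    simp [he]

namespace IsAdmissibleLaw

variable {m c : ℝ} {μ : Measure (ℝ × ℝ)} [IsProbabilityMeasure μ]

theorem lintegral_affinePayoff (h : IsAdmissibleLaw m c μ) (η w : ℝ) :
    ∫⁻ v, ENNReal.ofReal (affinePayoff η w v) ∂μ =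
      ENNReal.ofReal (∫ v, affinePayoff η w v ∂μ) :=
  (ofReal_integral_eq_lintegral_ofReal (h.integrable_affinePayoff η w)
    (ae_of_all _ (affinePayoff_nonneg η w))).symm

theorem lintegral_fst_mul_affinePayoff (h : IsAdmissibleLaw m c μ) (η w : ℝ) :
    ∫⁻ v, ENNReal.ofReal v.1 * ENNReal.ofReal (affinePayoff η w v) ∂μ =
      ENNReal.ofReal (∫ v, v.1 * affinePayoff η w v ∂μ) := by
  rw [ofReal_integral_eq_lintegral_ofReal (h.integrable_fst_mul_affinePayoff η w)]
  · exact lintegral_congr fun v => (ENNReal.ofReal_mul' (affinePayoff_nonneg η w v)).symm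
  · filter_upwards [h.fst_nonneg] with v hv
    exact mul_nonneg hv (affinePayoff_nonneg _ _ _)

omit [IsProbabilityMeasure μ] in
theorem integral_affinePayoff_nonneg (η w : ℝ) : 0 ≤ ∫ v, affinePayoff η w v ∂μ :=
  integral_nonneg (affinePayoff_nonneg η w)

omit [IsProbabilityMeasure μ] in
theorem integral_fst_mul_affinePayoff_nonneg (h : IsAdmissibleLaw m c μ) (η w : ℝ) :
    0 ≤ ∫ v, v.1 * affinePayoff η w v ∂μ := by
  refine integral_nonneg_of_ae ?_
  filter_upwards [h.fst_nonneg] with v hv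
  exact mul_nonneg hv (affinePayoff_nonneg _ _ _)

theorem lintegral_fst (h : IsAdmissibleLaw m c μ) : ∫⁻ v, ENNReal.ofReal v.1 ∂μ = 1 := by
  rw [← ofReal_integral_eq_lintegral_ofReal h.integrable_fst h.fst_nonneg, h.integral_fst,
    ENNReal.ofReal_one]

omit [IsProbabilityMeasure μ] in
theorem of_lintegral (h₁ : ∀ᵐ v ∂μ, 0 ≤ v.1 ∧ c ≤ v.2) (h₂ : ∫⁻ v, ENNReal.ofReal v.1 ∂μ = 1)
    (h₃ : ∫⁻ v, ENNReal.ofReal v.1 ^ 2 ∂μ = ENNReal.ofReal m)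
    (h₄ : ∫⁻ v, ENNReal.ofReal (v.2 ^ 2) ∂μ < ⊤) (hm : 0 ≤ m) : IsAdmissibleLaw m c μ := by
  have h₁' : ∀ᵐ v ∂μ, 0 ≤ v.1 := h₁.mono fun v hv => hv.1
  have h₃' : ∫⁻ v, ENNReal.ofReal (v.1 ^ 2) ∂μ = ENNReal.ofReal m := by
    rw [← h₃]
    refine lintegral_congr_ae ?_
    filter_upwards [h₁'] with v hv
    rw [ENNReal.ofReal_pow hv]
  refine ⟨h₁', ?_, ?_, ?_, ?_, h₁.mono fun v hv => hv.2⟩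
  · rw [memLp_two_iff_integrable_sq measurable_fst.aestronglyMeasurable]
    refine ⟨(measurable_fst.pow_const 2).aestronglyMeasurable, ?_⟩
    rw [hasFiniteIntegral_iff_ofReal (ae_of_all _ fun v => sq_nonneg _), h₃']
    exact ENNReal.ofReal_lt_top
  · rw [memLp_two_iff_integrable_sq measurable_snd.aestronglyMeasurable]
    refine ⟨(measurable_snd.pow_const 2).aestronglyMeasurable, ?_⟩
    rwa [hasFiniteIntegral_iff_ofReal (ae_of_all _ fun v => sq_nonneg _)]
  · rw [integral_eq_lintegral_of_nonneg_ae h₁' measurable_fst.aestronglyMeasurable, h₂,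
      ENNReal.toReal_one]
  · rw [integral_eq_lintegral_of_nonneg_ae (ae_of_all _ fun v => sq_nonneg _)
      (measurable_fst.pow_const 2).aestronglyMeasurable, h₃', ENNReal.toReal_ofReal hm]

end IsAdmissibleLaw

/-- A substitute law for the null set on which a conditional law fails to be admissible. -/
theorem isAdmissibleLaw_dirac {m : ℝ} (c : ℝ) (hm : 1 ≤ m) :
    IsAdmissibleLaw m c (Measure.dirac ((1, c) : ℝ × ℝ)) :=
  IsAdmissibleLaw.mk (by simp [ae_dirac_eq])
    ((memLp_const (1 : ℝ)).ae_eq (by rw [ae_dirac_eq]; rfl))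
    ((memLp_const c).ae_eq (by rw [ae_dirac_eq]; rfl))
    (by simp) (by simpa using hm) (by simp [ae_dirac_eq])

/-! ### Measurable dependence on the parameter -/

section Kernel

variable {E : Type*} [MeasurableSpace E] {κ : Kernel E (ℝ × ℝ)} [IsMarkovKernel κ]

theorem measurable_affinePayoff_comp {α : Type*} [MeasurableSpace α] {η w : α → ℝ}
    (hη : Measurable η) (hw : Measurable w) :
    Measurable fun p : α × (ℝ × ℝ) => affinePayoff (η p.1) (w p.1) p.2 := by
  unfold affinePayoff
  fun_prop

theorem measurable_integral_affinePayoff {η w : E → ℝ} (hη : Measurable η) (hw : Measurable w) :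
    Measurable fun e => ∫ v, affinePayoff (η e) (w e) v ∂(κ e) :=
  ((measurable_affinePayoff_comp hη hw).stronglyMeasurable.integral_kernel_prod_right').measurable

theorem measurable_integral_fst_mul_affinePayoff {η w : E → ℝ} (hη : Measurable η)
    (hw : Measurable w) : Measurable fun e => ∫ v, v.1 * affinePayoff (η e) (w e) v ∂(κ e) := by
  have : Measurable fun p : E × (ℝ × ℝ) => p.2.1 * affinePayoff (η p.1) (w p.1) p.2 :=
    (measurable_fst.comp measurable_snd).mul (measurable_affinePayoff_comp hη hw)
  exact (this.stronglyMeasurable.integral_kernel_prod_right').measurable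

/-- For a kernel of admissible laws, the solutions of the system depend measurably on the
parameter. -/
theorem exists_measurable_solution {m c a ρ k : ℝ} (hκ : ∀ e, IsAdmissibleLaw m c (κ e))
    (ha : 0 < a) (haρ : a < ρ) (hm : 0 < m) (hk : 0 < k) {b : E → ℝ} (hb : Measurable b) :
    ∃ η w : E → ℝ, Measurable η ∧ Measurable w ∧
      (∀ e, ∫ v, affinePayoff (η e) (w e) v ∂(κ e) = k) ∧
      ∀ e, ρ * m * w e - a * ∫ v, v.1 * affinePayoff (η e) (w e) v ∂(κ e) = b e := by
  choose η w h₁ h₂ using fun e => (hκ e).exists_solution ha haρ hm hk (b e)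
  -- The solutions are chosen pointwise. Monotonicity writes each sublevel set of `w` through `ε`,
  -- the `η` belonging to the constant `w = q`, and the sublevel sets of `ε` through kernel
  -- integrals at constants.
  have hw : Measurable w := by
    refine measurable_of_Iic fun q => ?_
    choose ε hε using fun e => (hκ e).exists_integral_affinePayoff_eq q hk
    have hεm : Measurable ε := by
      refine measurable_of_Iic fun p => ?_
      have : ε ⁻¹' Iic p = {e | k ≤ ∫ v, affinePayoff p q v ∂(κ e)} :=
        ext fun e => (hκ e).le_iff_le_integral_affinePayoff hk (hε e)
      rw [this]
      exact measurableSet_le measurable_const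
        (measurable_integral_affinePayoff measurable_const measurable_const)
    have : w ⁻¹' Iic q =
        {e | b e ≤ ρ * m * q - a * ∫ v, v.1 * affinePayoff (ε e) q v ∂(κ e)} :=
      ext fun e => (hκ e).le_iff_of_solution ha haρ hm hk (h₁ e) (h₂ e) (hε e)
    rw [this]
    exact measurableSet_le hb (measurable_const.sub
      ((measurable_integral_fst_mul_affinePayoff hεm measurable_const).const_mul a))
  refine ⟨η, w, measurable_of_Iic fun p => ?_, hw, h₁, h₂⟩
  have : η ⁻¹' Iic p = {e | k ≤ ∫ v, affinePayoff p (w e) v ∂(κ e)} :=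
    ext fun e => (hκ e).le_iff_le_integral_affinePayoff hk (h₁ e)
  rw [this]
  exact measurableSet_le measurable_const (measurable_integral_affinePayoff measurable_const hw)

end Kernel

/-! ### Conditional laws consisting of admissible laws -/

section Disintegration

variable {Ω E : Type*} [MeasurableSpace Ω] [MeasurableSpace E] {P : Measure Ω}
  [IsProbabilityMeasure P] {X : Ω → E} {V : Ω → ℝ × ℝ}

/-- `κ` is a version of the conditional law of `V` given `X` under `P`. -/
def IsCondLaw (P : Measure Ω) (X : Ω → E) (V : Ω → ℝ × ℝ) (κ : Kernel E (ℝ × ℝ)) : Prop :=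
  ∀ F : E × (ℝ × ℝ) → ENNReal, Measurable F →
    ∫⁻ ω, F (X ω, V ω) ∂P = ∫⁻ ω, ∫⁻ v, F (X ω, v) ∂(κ (X ω)) ∂P

/-- Conditional moment conditions on `V` given `X` produce a conditional law made of admissible
laws. -/
theorem exists_isCondLaw_isAdmissibleLaw (hX : Measurable X) (hV : Measurable V) {m c : ℝ}
    (hm : 1 ≤ m) (h₁ : ∀ᵐ ω ∂P, 0 ≤ (V ω).1 ∧ c ≤ (V ω).2)
    (h₂ : ∀ A, MeasurableSet A → ∫⁻ ω in X ⁻¹' A, ENNReal.ofReal (V ω).1 ∂P = P (X ⁻¹' A))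
    (h₃ : ∀ A, MeasurableSet A →
      ∫⁻ ω in X ⁻¹' A, ENNReal.ofReal (V ω).1 ^ 2 ∂P = P (X ⁻¹' A) * ENNReal.ofReal m)
    (h₄ : ∫⁻ ω, ENNReal.ofReal ((V ω).2 ^ 2) ∂P < ⊤) :
    ∃ κ : Kernel E (ℝ × ℝ), IsMarkovKernel κ ∧ (∀ e, IsAdmissibleLaw m c (κ e)) ∧
      IsCondLaw P X V κ := by
  set κ := condDistrib V X P with hκ
  have hc : P.map X ⊗ₘ κ = P.map fun ω => (X ω, V ω) := compProd_map_condDistrib hV.aemeasurable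
  have hXV : Measurable fun ω => (X ω, V ω) := hX.prodMk hV
  have : IsProbabilityMeasure (P.map X) := Measure.isProbabilityMeasure_map hX.aemeasurable
  have hset : ∀ f : ℝ × ℝ → ENNReal, Measurable f → ∀ A, MeasurableSet A →
      ∫⁻ e in A, ∫⁻ v, f v ∂(κ e) ∂(P.map X) = ∫⁻ ω in X ⁻¹' A, f (V ω) ∂P := by
    intro f hf A hA
    have hf' : Measurable fun p : E × (ℝ × ℝ) => f p.2 := hf.comp measurable_snd
    have := setLIntegral_map (hA.prod MeasurableSet.univ) hf' hXV (μ := P)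
    rw [← hc, Measure.setLIntegral_compProd hf' hA MeasurableSet.univ] at this
    simpa [mk_preimage_prod] using this
  have g₁ : ∀ᵐ e ∂(P.map X), ∀ᵐ v ∂(κ e), 0 ≤ v.1 ∧ c ≤ v.2 := by
    refine Measure.ae_ae_of_ae_compProd (p := fun p : E × (ℝ × ℝ) => 0 ≤ p.2.1 ∧ c ≤ p.2.2) ?_
    rw [hc, ae_map_iff hXV.aemeasurable]
    · exact h₁
    · exact (measurableSet_le measurable_const (measurable_fst.comp measurable_snd)).inter
        (measurableSet_le measurable_const (measurable_snd.comp measurable_snd))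
  have g₂ : ∀ᵐ e ∂(P.map X), ∫⁻ v, ENNReal.ofReal v.1 ∂(κ e) = 1 := by
    refine ae_eq_of_forall_setLIntegral_eq_of_sigmaFinite (μ := P.map X)
      (Measurable.lintegral_kernel (by fun_prop)) measurable_const fun A hA _ => ?_
    rw [hset (fun v => ENNReal.ofReal v.1) (by fun_prop) A hA, h₂ A hA, setLIntegral_const, one_mul,
      Measure.map_apply hX hA]
  have g₃ : ∀ᵐ e ∂(P.map X), ∫⁻ v, ENNReal.ofReal v.1 ^ 2 ∂(κ e) = ENNReal.ofReal m := by
    refine ae_eq_of_forall_setLIntegral_eq_of_sigmaFinite (μ := P.map X)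
      (Measurable.lintegral_kernel (by fun_prop)) measurable_const fun A hA _ => ?_
    rw [hset (fun v => ENNReal.ofReal v.1 ^ 2) (by fun_prop) A hA, h₃ A hA, setLIntegral_const,
      Measure.map_apply hX hA, mul_comm]
  have g₄ : ∀ᵐ e ∂(P.map X), ∫⁻ v, ENNReal.ofReal (v.2 ^ 2) ∂(κ e) < ⊤ := by
    refine ae_lt_top (Measurable.lintegral_kernel (by fun_prop)) ?_
    have := hset (fun v => ENNReal.ofReal (v.2 ^ 2)) (by fun_prop) univ MeasurableSet.univ
    rw [Measure.restrict_univ, preimage_univ, Measure.restrict_univ] at this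
    rw [this]
    exact h₄.ne
  have hgood : ∀ᵐ e ∂(P.map X), IsAdmissibleLaw m c (κ e) := by
    filter_upwards [g₁, g₂, g₃, g₄] with e e₁ e₂ e₃ e₄
    exact IsAdmissibleLaw.of_lintegral e₁ e₂ e₃ e₄ (zero_le_one.trans hm)
  -- Replacing the kernel on a measurable null set makes admissibility hold everywhere, so that the
  -- pointwise choice of solutions needs no exceptional set.
  obtain ⟨N, hN, hNm, hN0⟩ := exists_measurable_superset_of_null (ae_iff.1 hgood)
  classical
  set κ' := Kernel.piecewise hNm (Kernel.const E (Measure.dirac ((1, c) : ℝ × ℝ))) κ with hκ'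
  have hκκ' : ∀ᵐ ω ∂P, κ' (X ω) = κ (X ω) := by
    have : ∀ᵐ e ∂(P.map X), e ∉ N := measure_eq_zero_iff_ae_notMem.1 hN0
    filter_upwards [ae_of_ae_map hX.aemeasurable this] with ω hω
    rw [hκ', Kernel.piecewise_apply, if_neg hω]
  refine ⟨κ', inferInstance, fun e => ?_, fun F hF => ?_⟩
  · rw [hκ', Kernel.piecewise_apply]
    split_ifs with he
    · exact isAdmissibleLaw_dirac c hm
    · by_contra hcon
      exact he (hN hcon)
  · rw [← lintegral_map (f := F) hF hXV, ← hc, Measure.lintegral_compProd hF,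
      lintegral_map hF.lintegral_kernel_prod_right' hX]
    refine lintegral_congr_ae ?_
    filter_upwards [hκκ'] with ω hω
    rw [hω]

end Disintegration

/-! ### The conditional system and the tilted measure -/

section CondLaw

variable {Ω E : Type*} [MeasurableSpace Ω] [MeasurableSpace E] {P : Measure Ω}
  [IsProbabilityMeasure P] {X : Ω → E} {V : Ω → ℝ × ℝ} {κ : Kernel E (ℝ × ℝ)} [IsMarkovKernel κ]
  {m c : ℝ} {F : E × (ℝ × ℝ) → ENNReal} {L : E → ENNReal}

omit [IsProbabilityMeasure P] [IsMarkovKernel κ] in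
theorem IsCondLaw.setLIntegral (h : IsCondLaw P X V κ) (hX : Measurable X) (hF : Measurable F)
    {A : Set E} (hA : MeasurableSet A) :
    ∫⁻ ω in X ⁻¹' A, F (X ω, V ω) ∂P = ∫⁻ ω in X ⁻¹' A, ∫⁻ v, F (X ω, v) ∂(κ (X ω)) ∂P := by
  have hA' : MeasurableSet (X ⁻¹' A) := hX hA
  have := h ((Prod.fst ⁻¹' A).indicator F) (hF.indicator (measurable_fst hA))
  rw [← lintegral_indicator hA', ← lintegral_indicator hA']
  refine Eq.trans (lintegral_congr fun ω => ?_) (this.trans (lintegral_congr fun ω => ?_))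
  · by_cases hω : X ω ∈ A <;> simp [indicator, hω]
  · by_cases hω : X ω ∈ A <;> simp [indicator, hω]

theorem IsCondLaw.condLExp_eq (h : IsCondLaw P X V κ) (hX : Measurable X) (hF : Measurable F) :
    P⁻[fun ω => F (X ω, V ω) | MeasurableSpace.comap X inferInstance] =ᵐ[P]
      fun ω => ∫⁻ v, F (X ω, v) ∂(κ (X ω)) := by
  refine (ae_eq_condLExp hX.comap_le P _
    (hF.lintegral_kernel_prod_right'.comp (comap_measurable X)) ?_).symm
  rintro _ ⟨A, hA, rfl⟩
  exact (h.setLIntegral hX hF hA).symm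

/-- The measure with density `L(X) z` with respect to `P`, where `V = (z, y)`. -/
def tiltedMeasure (P : Measure Ω) (X : Ω → E) (V : Ω → ℝ × ℝ) (L : E → ENNReal) : Measure Ω :=
  P.withDensity fun ω => L (X ω) * ENNReal.ofReal (V ω).1

omit [IsProbabilityMeasure P] [IsMarkovKernel κ] in
theorem IsCondLaw.setLIntegral_tiltedMeasure (h : IsCondLaw P X V κ) (hX : Measurable X)
    (hV : Measurable V) (hL : Measurable L) (hF : Measurable F) {A : Set E}
    (hA : MeasurableSet A) :
    ∫⁻ ω in X ⁻¹' A, F (X ω, V ω) ∂(tiltedMeasure P X V L) =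
      ∫⁻ ω in X ⁻¹' A, L (X ω) * ∫⁻ v, ENNReal.ofReal v.1 * F (X ω, v) ∂(κ (X ω)) ∂P := by
  have hF' : Measurable fun p : E × (ℝ × ℝ) => L p.1 * (ENNReal.ofReal p.2.1 * F p) := by fun_prop
  rw [tiltedMeasure, restrict_withDensity (hX hA), lintegral_withDensity_eq_lintegral_mul _
    (by fun_prop) (by fun_prop)]
  refine Eq.trans ?_ ((h.setLIntegral hX hF' hA).trans ?_)
  · simp only [Pi.mul_apply, mul_assoc]
  · refine lintegral_congr fun ω => ?_
    rw [← lintegral_const_mul _ (by fun_prop)]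

-- On `σ(X)` the tilted measure has density `L(X)`, because `z` has conditional mean `1`.
omit [IsProbabilityMeasure P] in
theorem IsCondLaw.setLIntegral_tiltedMeasure_comp (h : IsCondLaw P X V κ)
    (hκ : ∀ e, IsAdmissibleLaw m c (κ e)) (hX : Measurable X)
    (hV : Measurable V) (hL : Measurable L) {g : E → ENNReal} (hg : Measurable g) {A : Set E}
    (hA : MeasurableSet A) :
    ∫⁻ ω in X ⁻¹' A, g (X ω) ∂(tiltedMeasure P X V L) =
      ∫⁻ ω in X ⁻¹' A, L (X ω) * g (X ω) ∂P := by
  rw [h.setLIntegral_tiltedMeasure hX hV hL (F := fun p => g p.1) (by fun_prop) hA]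
  refine lintegral_congr fun ω => ?_
  dsimp only
  rw [lintegral_mul_const _ (by fun_prop), (hκ (X ω)).lintegral_fst, one_mul]

-- Bayes' formula: `L(X)` is the density on `σ(X)`, so it cancels and only the weight `z` remains.
omit [IsProbabilityMeasure P] in
theorem IsCondLaw.condLExp_tiltedMeasure_eq (h : IsCondLaw P X V κ)
    (hκ : ∀ e, IsAdmissibleLaw m c (κ e)) (hX : Measurable X) (hV : Measurable V)
    (hL : Measurable L) (hF : Measurable F) [IsFiniteMeasure (tiltedMeasure P X V L)] :
    (tiltedMeasure P X V L)⁻[fun ω => F (X ω, V ω) | MeasurableSpace.comap X inferInstance]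
      =ᵐ[tiltedMeasure P X V L]
      fun ω => ∫⁻ v, ENNReal.ofReal v.1 * F (X ω, v) ∂(κ (X ω)) := by
  have hF' : Measurable fun p : E × (ℝ × ℝ) => ENNReal.ofReal p.2.1 * F p := by fun_prop
  have hm : Measurable fun e => ∫⁻ v, ENNReal.ofReal v.1 * F (e, v) ∂(κ e) :=
    hF'.lintegral_kernel_prod_right'
  refine (ae_eq_condLExp hX.comap_le _ _ (hm.comp (comap_measurable X)) ?_).symm
  rintro _ ⟨A, hA, rfl⟩
  rw [h.setLIntegral_tiltedMeasure hX hV hL hF hA]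
  exact h.setLIntegral_tiltedMeasure_comp hκ hX hV hL hm hA

/-- The conditional system with unknown `X`-measurable `(η, w)`, in conditional-expectation form,
is almost surely the deterministic system for the conditional law of `V` given `X`. -/
theorem IsCondLaw.system_iff (h : IsCondLaw P X V κ) (hκ : ∀ e, IsAdmissibleLaw m c (κ e))
    (hX : Measurable X) (hV : Measurable V) (hL : Measurable L)
    [IsFiniteMeasure (tiltedMeasure P X V L)] (hPQ : P ≪ tiltedMeasure P X V L) {a ρ k : ℝ}
    (ha : 0 < a) {b η w : E → ℝ} (hη : Measurable η) (hw : Measurable w) :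
    ((∀ᵐ ω ∂P, ((a * k : ℝ) : EReal) = (a : EReal) *
        (P⁻[fun ω => ENNReal.ofReal (affinePayoff (η (X ω)) (w (X ω)) (V ω)) |
          MeasurableSpace.comap X inferInstance] ω : EReal)) ↔
      ∀ᵐ ω ∂P, ∫ v, affinePayoff (η (X ω)) (w (X ω)) v ∂(κ (X ω)) = k) ∧
    ((∀ᵐ ω ∂P, ((ρ * m * w (X ω) - b (X ω) : ℝ) : EReal) = (a : EReal) *
        ((tiltedMeasure P X V L)⁻[fun ω =>
            ENNReal.ofReal (affinePayoff (η (X ω)) (w (X ω)) (V ω)) |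
          MeasurableSpace.comap X inferInstance] ω : EReal)) ↔
      ∀ᵐ ω ∂P, ρ * m * w (X ω) -
        a * ∫ v, v.1 * affinePayoff (η (X ω)) (w (X ω)) v ∂(κ (X ω)) = b (X ω)) := by
  have hF : Measurable fun p : E × (ℝ × ℝ) =>
      ENNReal.ofReal (affinePayoff (η p.1) (w p.1) p.2) :=
    (measurable_affinePayoff_comp hη hw).ennreal_ofReal
  have e1 := h.condLExp_eq hX hF
  have e2 := hPQ.ae_le (h.condLExp_tiltedMeasure_eq hκ hX hV hL hF)
  constructor
  · refine eventually_congr ?_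
    filter_upwards [e1] with ω hω
    rw [hω, (hκ (X ω)).lintegral_affinePayoff, EReal.coe_eq_coe_mul_coe_ennreal_iff ha,
      ENNReal.toReal_ofReal (IsAdmissibleLaw.integral_affinePayoff_nonneg _ _),
      mul_right_inj' ha.ne']
    simp [eq_comm]
  · refine eventually_congr ?_
    filter_upwards [e2] with ω hω
    rw [hω, (hκ (X ω)).lintegral_fst_mul_affinePayoff, EReal.coe_eq_coe_mul_coe_ennreal_iff ha,
      ENNReal.toReal_ofReal ((hκ (X ω)).integral_fst_mul_affinePayoff_nonneg _ _)]
    simp only [ne_eq, ENNReal.ofReal_ne_top, not_false_eq_true, true_and]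
    constructor <;> intro <;> linarith

/-- Integrability of the payoff under both measures for a solution of the deterministic systems. -/
theorem IsCondLaw.integrable_affinePayoff (h : IsCondLaw P X V κ)
    (hκ : ∀ e, IsAdmissibleLaw m c (κ e)) (hX : Measurable X) (hV : Measurable V)
    (hL : Measurable L) [IsFiniteMeasure (tiltedMeasure P X V L)] {a ρ k : ℝ}
    (ha : 0 < a) (haρ : a < ρ) (hm : 0 < m) (hk : 0 < k) {b η w : E → ℝ}
    (hb : Integrable (fun ω => b (X ω)) (tiltedMeasure P X V L))
    (hLY : ∫⁻ ω, L (X ω) * ENNReal.ofReal |(V ω).2| ∂P ≠ ⊤)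
    (hη : Measurable η) (hw : Measurable w)
    (h₁ : ∀ e, ∫ v, affinePayoff (η e) (w e) v ∂(κ e) = k)
    (h₂ : ∀ e, ρ * m * w e - a * ∫ v, v.1 * affinePayoff (η e) (w e) v ∂(κ e) = b e) :
    Integrable (fun ω => affinePayoff (η (X ω)) (w (X ω)) (V ω)) P ∧
      Integrable (fun ω => affinePayoff (η (X ω)) (w (X ω)) (V ω)) (tiltedMeasure P X V L) := by
  have hp := measurable_affinePayoff_comp hη hw
  have hF : Measurable fun p : E × (ℝ × ℝ) =>
      ENNReal.ofReal (affinePayoff (η p.1) (w p.1) p.2) := hp.ennreal_ofReal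
  have hm' : Measurable fun ω => affinePayoff (η (X ω)) (w (X ω)) (V ω) :=
    hp.comp (hX.prodMk hV)
  have hpos : 0 < (ρ - a) * m := mul_pos (sub_pos.2 haρ) hm
  constructor
  · refine ⟨hm'.aestronglyMeasurable, ?_⟩
    rw [hasFiniteIntegral_iff_ofReal (ae_of_all _ fun ω => affinePayoff_nonneg _ _ _), h _ hF]
    simp only [(hκ _).lintegral_affinePayoff, h₁]
    simp
  · have hYm : Measurable fun e => ∫ v, |v.2| ∂(κ e) := by
      have : Measurable fun p : E × (ℝ × ℝ) => |p.2.2| := by fun_prop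
      exact this.stronglyMeasurable.integral_kernel_prod_right'.measurable
    -- On functions of `X` the tilt acts through `L(X)` alone, so this reduces to the
    -- `P`-integrability of `L(X) |Y|`.
    have hY : Integrable (fun ω => ∫ v, |v.2| ∂(κ (X ω))) (tiltedMeasure P X V L) := by
      refine ⟨(hYm.comp hX).aestronglyMeasurable, ?_⟩
      rw [hasFiniteIntegral_iff_ofReal (ae_of_all _ fun ω => integral_nonneg fun v => abs_nonneg _)]
      have e1 := h.setLIntegral_tiltedMeasure_comp hκ hX hV hL
        (g := fun e => ENNReal.ofReal (∫ v, |v.2| ∂(κ e))) hYm.ennreal_ofReal MeasurableSet.univ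
      have hG : Measurable fun p : E × (ℝ × ℝ) => L p.1 * ENNReal.ofReal |p.2.2| := by fun_prop
      rw [preimage_univ, Measure.restrict_univ, Measure.restrict_univ] at e1
      rw [e1, lt_top_iff_ne_top]
      refine ne_of_eq_of_ne ?_ hLY
      rw [h _ hG]
      refine lintegral_congr fun ω => ?_
      dsimp only
      rw [lintegral_const_mul _ (by fun_prop), ofReal_integral_eq_lintegral_ofReal
        (hκ (X ω)).integrable_snd.abs (ae_of_all _ fun v => abs_nonneg _)]
    have hwi : Integrable (fun ω => w (X ω)) (tiltedMeasure P X V L) := by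
      have hbd : Integrable (fun ω => (|b (X ω)| + a * (k + ∫ v, |v.2| ∂(κ (X ω)) + |c|)) /
          ((ρ - a) * m)) (tiltedMeasure P X V L) :=
        (hb.abs.add ((((integrable_const k).add hY).add (integrable_const |c|)).const_mul
          a)).div_const _
      refine hbd.mono' (hw.comp hX).aestronglyMeasurable (ae_of_all _ fun ω => ?_)
      rw [Real.norm_eq_abs, le_div_iff₀ hpos, mul_comm]
      exact (hκ (X ω)).abs_solution_le ha haρ hm hk (h₁ (X ω)) (h₂ (X ω))
    refine ⟨hm'.aestronglyMeasurable, ?_⟩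
    rw [hasFiniteIntegral_iff_ofReal (ae_of_all _ fun ω => affinePayoff_nonneg _ _ _)]
    -- By the second equation this is the conditional mean of the payoff under the tilted measure,
    -- integrable because `w` and `b` are.
    have hq : Integrable (fun ω => (ρ * m * w (X ω) - b (X ω)) / a) (tiltedMeasure P X V L) :=
      ((hwi.const_mul (ρ * m)).sub hb).div_const a
    have hqe : ∀ e, (ρ * m * w e - b e) / a = ∫ v, v.1 * affinePayoff (η e) (w e) v ∂(κ e) :=
      fun e => by rw [div_eq_iff ha.ne']; linarith [h₂ e]
    simp only [hqe] at hq
    have hg := (measurable_integral_fst_mul_affinePayoff (κ := κ) hη hw).ennreal_ofReal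
    have e1 := h.setLIntegral_tiltedMeasure hX hV hL hF MeasurableSet.univ
    simp only [(hκ _).lintegral_fst_mul_affinePayoff] at e1
    rw [← h.setLIntegral_tiltedMeasure_comp hκ hX hV hL hg MeasurableSet.univ, preimage_univ,
      Measure.restrict_univ] at e1
    rw [e1, ← hasFiniteIntegral_iff_ofReal (ae_of_all _ fun ω =>
      (hκ (X ω)).integral_fst_mul_affinePayoff_nonneg _ _)]
    exact hq.2

end CondLaw

/-- Existence, uniqueness and integrability for the conditional system, when `V = (z, y)` satisfies
the conditional moment conditions given `X`. -/
theorem exists_unique_conditional_solution {Ω E : Type*} [MeasurableSpace Ω]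
    [mE : MeasurableSpace E] {P : Measure Ω} [IsProbabilityMeasure P] {X : Ω → E} {V : Ω → ℝ × ℝ}
    (hX : Measurable X) (hV : Measurable V) {m c a ρ k : ℝ} (hm : 1 ≤ m)
    (hVae : ∀ᵐ ω ∂P, 0 ≤ (V ω).1 ∧ c ≤ (V ω).2)
    (hmean : ∀ A, MeasurableSet A →
      ∫⁻ ω in X ⁻¹' A, ENNReal.ofReal (V ω).1 ∂P = P (X ⁻¹' A))
    (hsq : ∀ A, MeasurableSet A →
      ∫⁻ ω in X ⁻¹' A, ENNReal.ofReal (V ω).1 ^ 2 ∂P = P (X ⁻¹' A) * ENNReal.ofReal m)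
    (hY : ∫⁻ ω, ENNReal.ofReal ((V ω).2 ^ 2) ∂P < ⊤) {L : E → ENNReal} (hL : Measurable L)
    (hLY : ∫⁻ ω, L (X ω) * ENNReal.ofReal |(V ω).2| ∂P ≠ ⊤) {Q : Measure Ω} [IsFiniteMeasure Q]
    (hQ : tiltedMeasure P X V L = Q) (hPQ : P ≪ Q)
    (ha : 0 < a) (haρ : a < ρ) (hk : 0 < k) {b : E → ℝ} (hb : Measurable b)
    (hbQ : Integrable (fun ω => b (X ω)) Q) :
    ∃ η w : E → ℝ, Measurable η ∧ Measurable w ∧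
      (∀ᵐ ω ∂P, ((a * k : ℝ) : EReal) = (a : EReal) *
        (P⁻[fun ω => ENNReal.ofReal (affinePayoff (η (X ω)) (w (X ω)) (V ω)) |
          MeasurableSpace.comap X inferInstance] ω : EReal)) ∧
      (∀ᵐ ω ∂P, ((ρ * m * w (X ω) - b (X ω) : ℝ) : EReal) = (a : EReal) *
        (Q⁻[fun ω => ENNReal.ofReal (affinePayoff (η (X ω)) (w (X ω)) (V ω)) |
          MeasurableSpace.comap X inferInstance] ω : EReal)) ∧
      Integrable (fun ω => affinePayoff (η (X ω)) (w (X ω)) (V ω)) P ∧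
      Integrable (fun ω => affinePayoff (η (X ω)) (w (X ω)) (V ω)) Q ∧
      ∀ η' w' : E → ℝ, Measurable η' → Measurable w' →
        (∀ᵐ ω ∂P, ((a * k : ℝ) : EReal) = (a : EReal) *
          (P⁻[fun ω => ENNReal.ofReal (affinePayoff (η' (X ω)) (w' (X ω)) (V ω)) |
            MeasurableSpace.comap X inferInstance] ω : EReal)) →
        (∀ᵐ ω ∂P, ((ρ * m * w' (X ω) - b (X ω) : ℝ) : EReal) = (a : EReal) *
          (Q⁻[fun ω => ENNReal.ofReal (affinePayoff (η' (X ω)) (w' (X ω)) (V ω)) |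
            MeasurableSpace.comap X inferInstance] ω : EReal)) →
        ∀ᵐ ω ∂P, η' (X ω) = η (X ω) ∧ w' (X ω) = w (X ω) := by
  subst hQ
  obtain ⟨κ, hκm, hκ, h⟩ := exists_isCondLaw_isAdmissibleLaw hX hV hm hVae hmean hsq hY
  have hm0 : 0 < m := zero_lt_one.trans_le hm
  obtain ⟨η, w, hη, hw, h₁, h₂⟩ := exists_measurable_solution hκ ha haρ hm0 hk hb
  have hiff := h.system_iff hκ hX hV hL hPQ (ρ := ρ) (k := k) (b := b) ha hη hw
  have hint := h.integrable_affinePayoff hκ hX hV hL ha haρ hm0 hk hbQ hLY hη hw h₁ h₂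
  refine ⟨η, w, hη, hw, hiff.1.2 (ae_of_all _ fun ω => h₁ (X ω)),
    hiff.2.2 (ae_of_all _ fun ω => h₂ (X ω)), hint.1, hint.2, fun η' w' hη' hw' e₁ e₂ => ?_⟩
  have hiff' := h.system_iff hκ hX hV hL hPQ (ρ := ρ) (k := k) (b := b) ha hη' hw'
  filter_upwards [hiff'.1.1 e₁, hiff'.2.1 e₂] with ω e₁ e₂
  exact (hκ (X ω)).solution_unique ha haρ hm0 hk e₁ e₂ (h₁ (X ω)) (h₂ (X ω))

/-! ### Application to the Brownian system -/

theorem embeddingPayoff_eq_affinePayoff {Ω : Type*} [MeasurableSpace Ω] (P : Measure Ω) (T : ℝ)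
    (W : ℝ → Ω → ℝ) (ϑ : ℝ → ℝ) (ζ : Ω → ℝ) (θ ρ c t : ℝ) (h w : Ω → ℝ) :
    embeddingPayoff P T W ϑ ζ θ ρ c t h w = fun ω => affinePayoff (h ω / kappa P ζ) (w ω)
      (densityProcess P W ϑ T ω / densityProcess P W ϑ t ω, c + (θ + ρ) / (θ * ρ) * ζ ω) := by
  ext ω
  rw [embeddingPayoff, affinePayoff, sub_add_eq_sub_sub]

theorem theorem4p19 {Ω : Type*} [mΩ : MeasurableSpace Ω] (P : Measure Ω) [IsProbabilityMeasure P]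
    [P.IsComplete] (T : ℝ) (W : ℝ → Ω → ℝ) (hW : IsBrownianMotionOn P T W)
    (r ϑ : ℝ → ℝ) (hr : ContinuousOn r (Icc 0 T)) (hϑ : ContinuousOn ϑ (Icc 0 T))
    (hϑ_pos : ∀ s ∈ Icc (0 : ℝ) T, 0 < ϑ s)
    (ζ : Ω → ℝ) (hζ : MemLp ζ 2 P) (hζ_nonneg : ∀ᵐ ω ∂P, 0 ≤ ζ ω) (hζ_mean : ∫ ω, ζ ω ∂P < 1)
    (θ ρ c x : ℝ) (hθ : 0 < θ) (hρ : 0 < ρ)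
    (t z : ℝ) (ht : t ∈ Ico 0 T) (hz : 0 < z) :
    ∃ h w : Ω → ℝ,
      IsEmbeddingDualitySolution P T W r ϑ ζ θ ρ c x t z h w ∧
      Integrable (embeddingPayoff P T W ϑ ζ θ ρ c t h w) P ∧
      Integrable (embeddingPayoff P T W ϑ ζ θ ρ c t h w) (riskNeutralMeasure P T W ϑ) ∧
      (∀ᵐ ω ∂P,
        1 / ρ * Real.exp (-∫ v in t..T, |ϑ v| ^ 2) *
          (ρ * c - ρ * x * Real.exp (∫ v in t..T, r v)
            + ((riskNeutralMeasure P T W ϑ)[ζ | brownianFiltration P T W t]) ω) ≤ w ω) ∧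
      ∀ h' w' : Ω → ℝ,
        IsEmbeddingDualitySolution P T W r ϑ ζ θ ρ c x t z h' w' →
          h' =ᵐ[P] h ∧ w' =ᵐ[P] w := by
  have hT : 0 ≤ T := ht.1.trans ht.2.le
  have htT : t ∈ Icc 0 T := ⟨ht.1, ht.2.le⟩
  have hG := brownianFiltration_le hW t
  have hprob := isProbabilityMeasure_riskNeutralMeasure hW hT hϑ
  have hPQ : P ≪ riskNeutralMeasure P T W ϑ := by
    rw [← Measure.ae_le_iff_absolutelyContinuous]
    intro s hs
    exact (ae_riskNeutralMeasure_iff hW hT hϑ).1 hs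
  have hκ : 0 < kappa P ζ := sub_pos.2 hζ_mean
  have ha : 0 < θ * ρ / (θ + ρ) := by positivity
  have haρ : θ * ρ / (θ + ρ) < ρ := by
    rw [div_lt_iff₀ (by positivity)]
    nlinarith
  have hak : θ * ρ / (θ + ρ) * (kappa P ζ * z / (θ * ρ / (θ + ρ))) = kappa P ζ * z :=
    mul_div_cancel₀ _ ha.ne'
  have hm : 1 ≤ Real.exp (∫ v in t..T, |ϑ v| ^ 2) := Real.one_le_exp
    (intervalIntegral.integral_nonneg ht.2.le fun _ _ => sq_nonneg _)
  -- Completeness of `P` turns almost everywhere measurability into measurability.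
  have hζm : Measurable ζ := aemeasurable_iff_measurable.1 hζ.1.aemeasurable
  have hΛm : ∀ s ∈ Icc 0 T, Measurable (densityProcess P W ϑ s) := fun s hs =>
    aemeasurable_iff_measurable.1 (aestronglyMeasurable_densityProcess hW hϑ hs).aemeasurable
  set V : Ω → ℝ × ℝ := fun ω =>
    (densityProcess P W ϑ T ω / densityProcess P W ϑ t ω, c + (θ + ρ) / (θ * ρ) * ζ ω) with hVdef
  have hV : Measurable V :=
    ((hΛm T ⟨hT, le_rfl⟩).div (hΛm t htT)).prodMk ((hζm.const_mul _).const_add _)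
  have hYm : MemLp (fun ω => (V ω).2) 2 P := (memLp_const c).add (hζ.const_mul _)
  -- The factor `L` must be exactly `𝓕 t`-measurable, so `Λ_t` is replaced by an adapted version.
  obtain ⟨Λ, hΛ, hΛae⟩ := (aestronglyMeasurable_densityProcess_past hW hϑ htT).mono
    (rawPast_le_brownianFiltration ht.2.le)
  set Q := riskNeutralMeasure P T W ϑ with hQdef
  set b : Ω → ℝ := fun ω => ρ * (c - x * Real.exp (∫ v in t..T, r v)) +
    (Q[ζ | brownianFiltration P T W t]) ω with hbdef
  -- Taking `X` to be the identity into `Ω` with the σ-algebra `𝓕 t` makes conditioning on `X`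
  -- conditioning on `𝓕 t`, and functions of `X` the `𝓕 t`-measurable ones.
  have key := exists_unique_conditional_solution (mE := brownianFiltration P T W t)
    (P := P) (X := id) (V := V) (L := fun ω => ENNReal.ofReal (Λ ω)) (Q := Q) (c := c) (b := b)
    (m := Real.exp (∫ v in t..T, |ϑ v| ^ 2)) (a := θ * ρ / (θ + ρ)) (ρ := ρ)
    (k := kappa P ζ * z / (θ * ρ / (θ + ρ))) (measurable_id'' hG) hV hm ?_ ?_ ?_ ?_
    hΛ.measurable.ennreal_ofReal ?_ ?_ hPQ ha haρ (by positivity) ?_ ?_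
  rotate_left
  · filter_upwards [hζ_nonneg] with ω hω
    exact ⟨(div_pos (densityProcess_pos _ _) (densityProcess_pos _ _)).le,
      le_add_of_nonneg_right (by positivity)⟩
  · intro A hA
    have := setLIntegral_densityProcess_div_pow_of_brownianFiltration hW hϑ ht hA 1
    simpa using this
  · intro A hA
    have := setLIntegral_densityProcess_div_pow_of_brownianFiltration hW hϑ ht hA 2
    norm_num at this
    simpa using this
  · rw [← hasFiniteIntegral_iff_ofReal (ae_of_all _ fun ω => sq_nonneg _)]
    exact hYm.integrable_sq.2
  -- Both `Λ_t` and `Y` are in `L²(P)`, so their product is integrable.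
  · have hint : Integrable (fun ω => densityProcess P W ϑ t ω * |(V ω).2|) P :=
      (memLp_densityProcess hW hϑ htT).integrable_mul hYm.abs
    have h2 := hint.2
    rw [hasFiniteIntegral_iff_ofReal (ae_of_all _ fun ω =>
      mul_nonneg (densityProcess_pos _ _).le (abs_nonneg _))] at h2
    refine ne_of_eq_of_ne (lintegral_congr_ae ?_) h2.ne
    filter_upwards [hΛae] with ω hω
    rw [ENNReal.ofReal_mul (densityProcess_pos _ _).le, hω, id]
  · refine withDensity_congr_ae ?_
    filter_upwards [hΛae] with ω hω
    rw [id, ← hω, ← ENNReal.ofReal_mul (densityProcess_pos _ _).le,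
      mul_div_cancel₀ _ (densityProcess_pos _ _).ne']
  · exact stronglyMeasurable_condExp.measurable.const_add _
  · exact (integrable_const _).add integrable_condExp
  rw [show MeasurableSpace.comap (id : Ω → Ω) (brownianFiltration P T W t) =
    brownianFiltration P T W t from MeasurableSpace.comap_id] at key
  simp only [id] at key
  obtain ⟨η, w, hη, hw, e₁, e₂, i₁, i₂, huniq⟩ := key
  have hpay : embeddingPayoff P T W ϑ ζ θ ρ c t (fun ω => kappa P ζ * η ω) w =
      fun ω => affinePayoff (η ω) (w ω) (V ω) := by
    rw [embeddingPayoff_eq_affinePayoff]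
    simp only [mul_div_cancel_left₀ _ hκ.ne', hVdef]
  have hlhs : ∀ (w : Ω → ℝ) (ω : Ω), w ω * ρ * Real.exp (∫ v in t..T, |ϑ v| ^ 2)
        - ρ * (c - x * Real.exp (∫ v in t..T, r v)) - (Q[ζ | brownianFiltration P T W t]) ω =
      ρ * Real.exp (∫ v in t..T, |ϑ v| ^ 2) * w ω - b ω := by
    intro w ω
    rw [hbdef]
    ring
  refine ⟨fun ω => kappa P ζ * η ω, w, ⟨hη.const_mul _, hw, ?_, ?_⟩, ?_, ?_, ?_, ?_⟩
  · rw [hpay, ← hak]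
    exact e₁
  · rw [hpay]
    simp only [← hQdef, hlhs]
    exact e₂
  · rwa [hpay]
  · rwa [hpay]
  -- The right side of the second equation is nonnegative; solving `ρ m w ≥ b` for `w` gives the
  -- bound.
  · filter_upwards [e₂] with ω hω
    have hnonneg : 0 ≤ ρ * Real.exp (∫ v in t..T, |ϑ v| ^ 2) * w ω - b ω := by
      rw [((EReal.coe_eq_coe_mul_coe_ennreal_iff ha _ _).1 hω).2]
      positivity
    have hE := Real.exp_pos (∫ v in t..T, |ϑ v| ^ 2)
    rw [Real.exp_neg, one_div, ← mul_inv, inv_mul_le_iff₀ (by positivity)]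
    simp only [hbdef] at hnonneg
    linarith
  · intro h' w' hsol
    have hpay' : embeddingPayoff P T W ϑ ζ θ ρ c t h' w' =
        fun ω => affinePayoff (h' ω / kappa P ζ) (w' ω) (V ω) :=
      embeddingPayoff_eq_affinePayoff _ _ _ _ _ _ _ _ _ _ _
    have f₁ := hsol.first_eq
    have f₂ := hsol.second_eq
    rw [hpay', ← hak] at f₁
    rw [hpay'] at f₂
    simp only [← hQdef, hlhs] at f₂
    have := huniq (fun ω => h' ω / kappa P ζ) w' (hsol.measurable_h.div_const _)
      hsol.measurable_w f₁ f₂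
    constructor
    · filter_upwards [this] with ω hω
      rw [← hω.1, mul_div_cancel₀ _ hκ.ne']
    · exact this.mono fun ω hω => hω.2

end
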